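/- Setting. Two agents act in a finite MDP with state set $S$, action sets $A_1,A_2$, transition kernel $P(s,a^1,a^2,\cdot)$, joint reward $r:S\times A_1\times A_2\to[0,1]$ and initial state distribution $d_1$. A policy $\pi^i$ of agent $i$ assigns to every state a probability distribution on $A_i$; write $P_{\pi^1,\pi^2}$ for the induced state transition matrix, $r_{\pi^2}(s,a^1)=\sum_{a^2}\pi^2(s,a^2)r(s,a^1,a^2)$ and $r_{\pi^1,\pi^2}(s)=\sum_{a^1}\pi^1(s,a^1)r_{\pi^2}(s,a^1)$. There is a mixing time $\omega>0$: $\|dP_{\pi^1,\pi^2}-d'P_{\pi^1,\pi^2}\|_1\le e^{-1/\omega}\|d-d'\|_1$ for all policy pairs and all state distributions $d,d'$. Hence every policy pair has a unique stationary distribution $d_{\pi^1,\pi^2}$, to which every initial distribution converges. Put $\eta_{\pi^2}(\pi^1)=d_{\pi^1,\pi^2}\cdot r_{\pi^1,\pi^2}$. In each episode $t=1,\dots,T$, consisting of $M$ rounds, the agents commit to policies $\pi^1_t,\pi^2_t$ and then observe each other's policy. The return is $V_t=\frac1M\sum_{m=1}^M d_1P_{\pi^1_t,\pi^2_t}^{m-1}\cdot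 r_{\pi^1_t,\pi^2_t}$, $\bar V=\frac1T\sum_{t=1}^T V_t$, and $\mathrm{OPT}$ is the maximum of $\bar V$ over all policies of both agents. The regret of agent $\mathcal A_1$ is $R(T)=\sup_{\pi^1}\sum_{t=1}^T(\eta_{\pi^2_t}(\pi^1)-\eta_{\pi^2_t}(\pi^1_t))$, and $\rho_2=\max_{1<t\le T}\max_s\sum_{a^2}|\pi^2_t(s,a^2)-\pi^2_{t-1}(s,a^2)|$ is the policy change magnitude of agent $\mathcal A_2$ ($\rho_2=0$ if $T=1$). The MDP is $(\lambda,\mu)$-smooth if there are policies $\pi^{1*},\pi^{2*}$ such that for all $\pi^1,\pi^2$: $\eta_{\pi^2}(\pi^{1*})\ge\lambda\,\eta_{\pi^{2*}}(\pi^{1*})-\mu\,\eta_{\pi^2}(\pi^1)$ and $\eta_{\pi^{2*}}(\pi^{1*})\ge\eta_{\pi^2}(\pi^1)$. Algorithm ExpDRBias. Let $\mathcal R$ be a regularizer on the probability simplex $\mathcal P_{A_1}$ that is 1-strongly convex with respect to $\|\cdot\|_1$, and let $\Delta_{\mathcal R}=\sup\mathcal R-\inf\mathcal R$ there. Let $Q_t(s,a^1)=\mathbb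 E[\sum_{m\ge1}(r_{\pi^2_t}(s_m,a^1_m)-\eta_{\pi^2_t}(\pi^1_t))]$ (the sum of the expectations of the terms), starting with $s_1=s$, $a^1_1=a^1$ and following $\pi^1_t,\pi^2_t$ otherwise; $Q_t=0$ for $t<1$. With learning rate $\epsilon>0$ and horizon $\Gamma\in\mathbb N$, agent $\mathcal A_1$ plays $$\pi^1_t=\frac1\Gamma\sum_{\tau=1}^{\Gamma}w_{t,\tau},\qquad w_{t,\tau}(s)\in\arg\max_{w\in\mathcal P_{A_1}}\Big\{\Big\langle \sum_{k=1}^{\tau-1}Q_{t-k}(s)+Q_{t-1}(s),\,w\Big\rangle-\frac{\mathcal R(w)}{\epsilon}\Big\}.$$ Theorem. Let $\alpha>0$ and $c,D\in\mathbb R$, and suppose that $\rho_2\le c\,T^{-\alpha}$ and $\Delta_{\mathcal R}\le D$. Run ExpDRBias with $\Gamma=\min\{T^{4\alpha/7},T\}$, rounded down or up to an integer, and $\epsilon=\Gamma^{-1/4}$. (1) There is a constant $C$, depending only on $\alpha,c,\omega,D$, such that for all $T\ge1$ $$R(T)\le C\,T^{\max\{1-\frac37\alpha,\frac14\}}.$$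 (2) For all $\lambda$ and all $\mu>-1$ there are constants $C_1,C_2$, depending only on $\alpha,c,\omega,D,\lambda,\mu$, such that, if the MDP is $(\lambda,\mu)$-smooth, then for all $T,M\ge1$ $$\bar V\ge\frac{\lambda}{1+\mu}\,\mathrm{OPT}-C_1\,T^{\max\{-\frac37\alpha,-\frac34\}}-C_2\,M^{-1}.$$ -/

import Mathlib

open scoped Matrix Topology

universe u v w

noncomputable section

namespace TwoAgent

/-- A finite two-agent Markov decision process with joint rewards in `[0, 1]` and a fixed
distribution of the initial state. -/
structure MDP (S A₁ A₂ : Type*) [Fintype S] where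
  trans : S → A₁ → A₂ → stdSimplex ℝ S
  reward : S → A₁ → A₂ → ℝ
  reward_mem : ∀ s a b, reward s a b ∈ Set.Icc (0 : ℝ) 1
  init : stdSimplex ℝ S

/-- A stationary policy: in every state a probability distribution on the actions. -/
abbrev Policy (S A : Type*) [Fintype A] := S → stdSimplex ℝ A

/-- The operator (row-sum) norm of the difference of two policies, `max_s ∑_a |π(s,a) - π'(s,a)|`,
maximised over the episodes `t` and `t - 1` with `2 ≤ t ≤ T`; it is `0` if there is no such `t`. -/
def policyChange {S A : Type*} [Fintype A] (T : ℕ) (π : ℕ → Policy S A) : ℝ :=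
  sSup {x : ℝ | ∃ t : ℕ, ∃ s : S, 2 ≤ t ∧ t ≤ T ∧
    x = ∑ a, |(π t s).1 a - (π (t - 1) s).1 a|}

section

variable {S A₁ A₂ : Type*} [Fintype S] [Fintype A₁] [Fintype A₂]

namespace MDP

/-- The law of the next state, given the state and the action of the first agent. -/
def actionKernel (G : MDP S A₁ A₂) (π₂ : Policy S A₂) (s : S) (a : A₁) : S → ℝ :=
  fun s' => ∑ b, (π₂ s).1 b * (G.trans s a b).1 s'

/-- The transition matrix of the Markov chain of states under a pair of policies. -/
def kernel (G : MDP S A₁ A₂) (π₁ : Policy S A₁) (π₂ : Policy S A₂) : Matrix S S ℝ :=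
  fun s s' => ∑ a, (π₁ s).1 a * G.actionKernel π₂ s a s'

/-- The reward matrix of the first agent, `r(s, a) = E_{b ∼ π₂(s)} r(s, a, b)`. -/
def reward₁ (G : MDP S A₁ A₂) (π₂ : Policy S A₂) (s : S) (a : A₁) : ℝ :=
  ∑ b, (π₂ s).1 b * G.reward s a b

/-- The expected one-round reward in each state. -/
def stateReward (G : MDP S A₁ A₂) (π₁ : Policy S A₁) (π₂ : Policy S A₂) (s : S) : ℝ :=
  ∑ a, (π₁ s).1 a * G.reward₁ π₂ s a

/-- The distribution of the state after `k` further rounds, starting from the distribution `d`. -/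
def stateDist (G : MDP S A₁ A₂) (π₁ : Policy S A₁) (π₂ : Policy S A₂) (d : S → ℝ) (k : ℕ) :
    S → ℝ :=
  (fun e : S → ℝ => e ᵥ* G.kernel π₁ π₂)^[k] d

/-- The joint return of an episode of `M` rounds (the state of round `m` is reached after `m - 1`
transitions, so `k` below is `m - 1`). -/
def episodeReturn (G : MDP S A₁ A₂) (M : ℕ) (π₁ : Policy S A₁) (π₂ : Policy S A₂) : ℝ :=
  (1 / (M : ℝ)) * ∑ k ∈ Finset.range M,
    G.stateDist π₁ π₂ G.init.1 k ⬝ᵥ G.stateReward π₁ π₂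

/-- The average return over the episodes `1, …, T`. -/
def avgReturn (G : MDP S A₁ A₂) (T M : ℕ) (π₁ : ℕ → Policy S A₁) (π₂ : ℕ → Policy S A₂) : ℝ :=
  (1 / (T : ℝ)) * ∑ t ∈ Finset.Icc 1 T, G.episodeReturn M (π₁ t) (π₂ t)

/-- The largest average return over all choices of the policies of both agents. -/
def opt (G : MDP S A₁ A₂) (T M : ℕ) : ℝ :=
  ⨆ π : (ℕ → Policy S A₁) × (ℕ → Policy S A₂), G.avgReturn T M π.1 π.2

/-- `ω` is a mixing time: for every pair of policies, one round contracts the `ℓ¹` distance of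
state distributions by the factor `e^{-1/ω}`. -/
def IsMixingTime (G : MDP S A₁ A₂) (ω : ℝ) : Prop :=
  ∀ (π₁ : Policy S A₁) (π₂ : Policy S A₂), ∀ d ∈ stdSimplex ℝ S, ∀ d' ∈ stdSimplex ℝ S,
    ∑ s, |(d ᵥ* G.kernel π₁ π₂) s - (d' ᵥ* G.kernel π₁ π₂) s| ≤
      Real.exp (-1 / ω) * ∑ s, |d s - d' s|

/-- `d` is the stationary state distribution: it is invariant, and every initial distribution
converges to it. -/
def IsStationary (G : MDP S A₁ A₂) (π₁ : Policy S A₁) (π₂ : Policy S A₂) (d : S → ℝ) : Prop :=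
  d ∈ stdSimplex ℝ S ∧ d ᵥ* G.kernel π₁ π₂ = d ∧
    ∀ e ∈ stdSimplex ℝ S,
      Filter.Tendsto (fun k : ℕ => G.stateDist π₁ π₂ e k) Filter.atTop (𝓝 d)

theorem kernel_vecMul_mem (G : MDP S A₁ A₂) (π₁ : Policy S A₁) (π₂ : Policy S A₂) {d : S → ℝ}
    (hd : d ∈ stdSimplex ℝ S) : d ᵥ* G.kernel π₁ π₂ ∈ stdSimplex ℝ S := by
  have hA : ∀ s a s', 0 ≤ G.actionKernel π₂ s a s' := fun s a s' =>
    Finset.sum_nonneg fun b _ => mul_nonneg ((π₂ s).2.1 b) ((G.trans s a b).2.1 s')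
  have hA1 : ∀ s a, ∑ s', G.actionKernel π₂ s a s' = 1 := by
    intro s a
    simp only [actionKernel]
    rw [Finset.sum_comm]
    simp only [← Finset.mul_sum]
    rw [← (π₂ s).2.2]
    exact Finset.sum_congr rfl fun b _ => by rw [(G.trans s a b).2.2, mul_one]
  have hK : ∀ s s', 0 ≤ G.kernel π₁ π₂ s s' := fun s s' =>
    Finset.sum_nonneg fun a _ => mul_nonneg ((π₁ s).2.1 a) (hA s a s')
  have hK1 : ∀ s, ∑ s', G.kernel π₁ π₂ s s' = 1 := by
    intro s
    simp only [kernel]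
    rw [Finset.sum_comm]
    simp only [← Finset.mul_sum, hA1, mul_one]
    exact (π₁ s).2.2
  refine ⟨fun s' => Finset.sum_nonneg fun s _ => mul_nonneg (hd.1 s) (hK s s'), ?_⟩
  simp only [Matrix.vecMul, dotProduct]
  rw [Finset.sum_comm]
  simp only [← Finset.mul_sum, hK1, mul_one]
  exact hd.2

/-- A mixing time gives every pair of policies exactly one stationary distribution. -/
theorem existsUnique_isStationary (G : MDP S A₁ A₂) {ω : ℝ} (hω : 0 < ω) (h : G.IsMixingTime ω)
    (π₁ : Policy S A₁) (π₂ : Policy S A₂) : ∃! d, G.IsStationary π₁ π₂ d := by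
  set f : (S → ℝ) → S → ℝ := fun e => e ᵥ* G.kernel π₁ π₂ with hf
  set q : ℝ := Real.exp (-1 / ω) with hq
  have hq0 : 0 ≤ q := (Real.exp_pos _).le
  have hq1 : q < 1 := by
    rw [hq, Real.exp_lt_one_iff]
    exact div_neg_of_neg_of_pos (by norm_num) hω
  have hmem : ∀ (n : ℕ) (e : S → ℝ), e ∈ stdSimplex ℝ S → f^[n] e ∈ stdSimplex ℝ S := by
    intro n
    induction n with
    | zero => exact fun e he => he
    | succ n ih => exact fun e he => ih _ (G.kernel_vecMul_mem π₁ π₂ he)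
  have hcon : ∀ (n : ℕ), ∀ e ∈ stdSimplex ℝ S, ∀ e' ∈ stdSimplex ℝ S,
      ∑ s, |(f^[n] e) s - (f^[n] e') s| ≤ q ^ n * ∑ s, |e s - e' s| := by
    intro n
    induction n with
    | zero => intro e _ e' _; simp
    | succ n ih =>
      intro e he e' he'
      have h1 := ih _ (G.kernel_vecMul_mem π₁ π₂ he) _ (G.kernel_vecMul_mem π₁ π₂ he')
      have h2 := h π₁ π₂ e he e' he'
      calc _ ≤ q ^ n * ∑ s, |f e s - f e' s| := h1
        _ ≤ q ^ n * (q * ∑ s, |e s - e' s|) := by gcongr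
        _ = _ := by ring
  have hdist : ∀ x y : S → ℝ, dist x y ≤ ∑ s, |x s - y s| := by
    intro x y
    refine (dist_pi_le_iff (Finset.sum_nonneg fun _ _ => abs_nonneg _)).2 fun s => ?_
    rw [Real.dist_eq]
    exact Finset.single_le_sum (f := fun s => |x s - y s|) (fun _ _ => abs_nonneg _)
      (Finset.mem_univ s)
  have hcauchy : CauchySeq fun n => f^[n] G.init.1 := by
    refine cauchySeq_of_le_geometric q (∑ s, |G.init.1 s - f G.init.1 s|) hq1 fun n => ?_
    refine (hdist _ _).trans ?_
    rw [mul_comm]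
    exact hcon n _ G.init.2 _ (G.kernel_vecMul_mem π₁ π₂ G.init.2)
  obtain ⟨d, hd⟩ := cauchySeq_tendsto_of_complete hcauchy
  have hdmem : d ∈ stdSimplex ℝ S :=
    (isClosed_stdSimplex ℝ S).mem_of_tendsto hd (Filter.Eventually.of_forall fun n =>
      hmem n _ G.init.2)
  have hcont : Continuous f := continuous_id.matrix_vecMul continuous_const
  have hfix : f d = d := by
    refine tendsto_nhds_unique ((hcont.tendsto d).comp hd) ?_
    have := (Filter.tendsto_add_atTop_iff_nat 1).2 hd
    refine this.congr fun n => ?_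
    exact Function.iterate_succ_apply' f n _
  have hlim : ∀ e ∈ stdSimplex ℝ S, Filter.Tendsto (fun k : ℕ => f^[k] e) Filter.atTop (𝓝 d) := by
    intro e he
    refine tendsto_iff_dist_tendsto_zero.2 ?_
    have hz : Filter.Tendsto (fun n : ℕ => q ^ n * ∑ s, |e s - d s|) Filter.atTop (𝓝 0) := by
      simpa using (tendsto_pow_atTop_nhds_zero_of_lt_one hq0 hq1).mul_const (∑ s, |e s - d s|)
    refine squeeze_zero (fun _ => dist_nonneg) (fun n => ?_) hz
    refine (hdist _ _).trans ?_
    have := hcon n e he d hdmem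
    rwa [Function.iterate_fixed hfix n] at this
  refine ⟨d, ⟨hdmem, hfix, hlim⟩, fun d' hd' => ?_⟩
  exact tendsto_nhds_unique (hd'.2.2 _ G.init.2) (hlim _ G.init.2)

/-- The stationary state distribution under a pair of policies (arbitrary if there is none; see
`existsUnique_isStationary`). -/
def stationaryDist (G : MDP S A₁ A₂) (π₁ : Policy S A₁) (π₂ : Policy S A₂) : S → ℝ :=
  Classical.epsilon (G.IsStationary π₁ π₂)

/-- The average reward `η_{π₂}(π₁)`. -/
def avgReward (G : MDP S A₁ A₂) (π₁ : Policy S A₁) (π₂ : Policy S A₂) : ℝ :=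
  G.stationaryDist π₁ π₂ ⬝ᵥ G.stateReward π₁ π₂

/-- The expected reward in round `m + 1`, when the first round starts in the state `s` with the
action `a` of the first agent, and the policies are followed otherwise. -/
def roundReward (G : MDP S A₁ A₂) (π₁ : Policy S A₁) (π₂ : Policy S A₂) (s : S) (a : A₁) :
    ℕ → ℝ
  | 0 => G.reward₁ π₂ s a
  | k + 1 => G.stateDist π₁ π₂ (G.actionKernel π₂ s a) k ⬝ᵥ G.stateReward π₁ π₂

/-- The `Q`-values of the first agent for the pair `(π₁, π₂)`: the expected total excess of the
rewards over the average reward. -/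
def qValue (G : MDP S A₁ A₂) (π₁ : Policy S A₁) (π₂ : Policy S A₂) (s : S) (a : A₁) : ℝ :=
  ∑' m : ℕ, (G.roundReward π₁ π₂ s a m - G.avgReward π₁ π₂)

/-- The regret of the first agent over the episodes `1, …, T`. -/
def regret (G : MDP S A₁ A₂) (T : ℕ) (π₁ : ℕ → Policy S A₁) (π₂ : ℕ → Policy S A₂) : ℝ :=
  ⨆ π : Policy S A₁, ∑ t ∈ Finset.Icc 1 T,
    (G.avgReward π (π₂ t) - G.avgReward (π₁ t) (π₂ t))

/-- `(lam, mu)`-smoothness of the MDP. -/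
def IsSmooth (G : MDP S A₁ A₂) (lam mu : ℝ) : Prop :=
  ∃ (σ₁ : Policy S A₁) (σ₂ : Policy S A₂), ∀ (π₁ : Policy S A₁) (π₂ : Policy S A₂),
    G.avgReward σ₁ π₂ ≥ lam * G.avgReward σ₁ σ₂ - mu * G.avgReward π₁ π₂ ∧
    G.avgReward σ₁ σ₂ ≥ G.avgReward π₁ π₂

/-- The `Q`-values of episode `t ≥ 1`, and `0` where there is no such episode. -/
def qHist (G : MDP S A₁ A₂) (π₁ : ℕ → Policy S A₁) (π₂ : ℕ → Policy S A₂) (t : ℕ) (s : S)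
    (a : A₁) : ℝ :=
  if t = 0 then 0 else G.qValue (π₁ t) (π₂ t) s a

/-- The optimistic cumulative `Q`-values `∑_{k=1}^{τ-1} Q_{t-k} + Q_{t-1}` in episode `t` of the
expert that looks back over a window of length `τ - 1` (for `k ≥ t` the truncated difference
`t - k` is `0`, so the summand vanishes). -/
def windowQ (G : MDP S A₁ A₂) (π₁ : ℕ → Policy S A₁) (π₂ : ℕ → Policy S A₂) (t τ : ℕ) (s : S)
    (a : A₁) : ℝ :=
  ∑ k ∈ Finset.Icc 1 (τ - 1), G.qHist π₁ π₂ (t - k) s a + G.qHist π₁ π₂ (t - 1) s a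

/-- The policies `π₁` of the first agent in the episodes `1, …, T` are those that the algorithm
ExpDRBias (experts with double recency bias) with regularizer `R`, horizon `Γ` and learning rate
`ε` plays against the policies `π₂` of the second agent. In every state `s` and episode `t`, the
weights `w t τ s` are the optimistic follow-the-regularized-leader update on the last `τ - 1`
episodes, and the policy is the average of these weights over `τ = 1, …, Γ`. The update for
episode `t` uses the policies of the episodes before `t` only. -/
def IsExpDRBias (G : MDP S A₁ A₂) (R : (A₁ → ℝ) → ℝ) (Γ : ℕ) (ε : ℝ) (T : ℕ)
    (π₁ : ℕ → Policy S A₁) (π₂ : ℕ → Policy S A₂) : Prop :=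
  ∃ w : ℕ → ℕ → Policy S A₁,
    (∀ t ∈ Finset.Icc 1 T, ∀ τ ∈ Finset.Icc 1 Γ, ∀ s,
      IsMaxOn (fun v : A₁ → ℝ => ∑ a, G.windowQ π₁ π₂ t τ s a * v a - R v / ε)
        (stdSimplex ℝ A₁) (w t τ s).1) ∧
    ∀ t ∈ Finset.Icc 1 T, ∀ s a,
      (π₁ t s).1 a = (1 / (Γ : ℝ)) * ∑ τ ∈ Finset.Icc 1 Γ, (w t τ s).1 a

end MDP

end

/-- `R` is `1`-strongly convex on the probability simplex with respect to the `ℓ¹` norm. -/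
def IsRegularizer {A : Type*} [Fintype A] (R : (A → ℝ) → ℝ) : Prop :=
  ∀ x ∈ stdSimplex ℝ A, ∀ y ∈ stdSimplex ℝ A, ∀ a b : ℝ, 0 ≤ a → 0 ≤ b → a + b = 1 →
    R (a • x + b • y) ≤ a * R x + b * R y - a * b / 2 * (∑ i, |x i - y i|) ^ 2

/-- The range `Δ_R = sup R - inf R` of `R` on the probability simplex. -/
def regularizerRange {A : Type*} [Fintype A] (R : (A → ℝ) → ℝ) : ℝ :=
  sSup (R '' stdSimplex ℝ A) - sInf (R '' stdSimplex ℝ A)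

/-- The horizon `Γ = min {T^{4α/7}, T}`, rounded down or up to an integer. -/
def IsHorizon (α : ℝ) (T Γ : ℕ) : Prop :=
  Γ = ⌊min ((T : ℝ) ^ (4 / 7 * α)) (T : ℝ)⌋₊ ∨ Γ = ⌈min ((T : ℝ) ^ (4 / 7 * α)) (T : ℝ)⌉₊

end TwoAgent

end

/-!
Why the regret and return bounds of ExpDRBias hold.

**Reduction to payoffs per state.** By the performance difference lemma
(`MDP.IsMixingTime.avgReward_sub_eq`), the loss against a fixed policy `π` in episode `t` is
`∑ s, d_t(s) ⟨Q_t(s), π(s) - π¹_t(s)⟩`, where `d_t` is the stationary distribution of `π` against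
the policy of the other agent. In every state the learner thus faces an online linear problem
with payoffs `Q_t(s)`, except that the weights `d_t(s)` change with `t`.

**Consequences of mixing.** The contraction of the kernel on vectors of total mass `0` bounds the
`Q`-values (`MDP.IsMixingTime.abs_qValue_le`) and makes the stationary distributions and the
`Q`-values Lipschitz in the policies (`MDP.IsMixingTime.l1_stationaryDist_sub_le`,
`MDP.IsMixingTime.abs_qValue_sub_le`), with constants that depend on the mixing time only.

**Runs of experts.** Expert `τ` in episode `t` looks back to episode `t - τ + 1`. Grouping the
pairs `(t, τ)` by this starting point (`sum_experts_eq_sum_runs`) exhibits the regret as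
`1 / Γ` times the total regret of fewer than `T + Γ` runs of optimistic
follow-the-regularized-leader, each of length at most `Γ`. Each run has regret at most `Δ_R / ε`
plus `ε / 2` times the squared prediction errors `‖Q_t - Q_{t-1}‖²`
(`IsRegularizer.optimistic_regret_le`). Within a run, `d_t` may be replaced by
its value at the start of the run at a cost of order `Γ ρ₂` per episode
(`MDP.IsMixingTime.run_regret_le`). The maximizers move by `O(ε)` per episode
(`MDP.IsMixingTime.l1_policy_sub_le`), so the prediction errors are `O(ε + ρ₂)`, save for an
error `O(1)` in episode `1`, which nothing precedes. Hence the regret is of order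
`T / (ε Γ) + ε + T ε (ε + ρ₂)² + T Γ ρ₂`
(`MDP.IsExpDRBias.sum_avgReward_sub_le`). For `ε = Γ^{-1/4}` this is governed by `T Γ^{-3/4}` and
`T Γ T^{-α}`, which the horizon `Γ ≈ min {T^{4α/7}, T}` balances (`IsHorizon.rates`).

**Return.** Returns and optimum differ from average rewards by `O(1 / M)`, by mixing. In a smooth
MDP, the regret bound against the smoothness policy, rearranged, bounds the mean average reward
from below (`MDP.IsSmooth.le_avgReturn`).
-/

/-! ### The `ℓ¹` norm -/

namespace TwoAgent

/-- The `ℓ¹` norm of a real vector (the norm instance of a function type is the sup norm). -/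
def l1 {ι : Type*} [Fintype ι] (x : ι → ℝ) : ℝ := ∑ i, |x i|

section L1

variable {ι κ : Type*} [Fintype ι]

theorem l1_nonneg (x : ι → ℝ) : 0 ≤ l1 x := Finset.sum_nonneg fun _ _ => abs_nonneg _

@[simp] theorem l1_zero : l1 (0 : ι → ℝ) = 0 := by simp [l1]

theorem l1_add_le (x y : ι → ℝ) : l1 (x + y) ≤ l1 x + l1 y := by
  rw [l1, l1, l1, ← Finset.sum_add_distrib]
  exact Finset.sum_le_sum fun i _ => abs_add_le _ _

theorem l1_sub_le (x y : ι → ℝ) : l1 (x - y) ≤ l1 x + l1 y := by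
  rw [l1, l1, l1, ← Finset.sum_add_distrib]
  exact Finset.sum_le_sum fun i _ => abs_sub _ _

theorem l1_sub_comm (x y : ι → ℝ) : l1 (x - y) = l1 (y - x) :=
  Finset.sum_congr rfl fun _ _ => abs_sub_comm _ _

theorem l1_sub_le_trans (x y z : ι → ℝ) : l1 (x - z) ≤ l1 (x - y) + l1 (y - z) := by
  have := l1_add_le (x - y) (y - z)
  rwa [sub_add_sub_cancel] at this

theorem l1_smul (c : ℝ) (x : ι → ℝ) : l1 (c • x) = |c| * l1 x := by
  simp [l1, abs_mul, Finset.mul_sum]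

theorem l1_sum_le (s : Finset κ) (f : κ → ι → ℝ) : l1 (∑ k ∈ s, f k) ≤ ∑ k ∈ s, l1 (f k) := by
  classical
  induction s using Finset.induction_on with
  | empty => simp
  | insert a s ha ih =>
    rw [Finset.sum_insert ha, Finset.sum_insert ha]
    exact (l1_add_le _ _).trans (by gcongr)

theorem l1_of_mem_stdSimplex {x : ι → ℝ} (hx : x ∈ stdSimplex ℝ ι) : l1 x = 1 := by
  rw [l1, ← hx.2]
  exact Finset.sum_congr rfl fun i _ => abs_of_nonneg (hx.1 i)

theorem l1_sub_le_two {x y : ι → ℝ} (hx : x ∈ stdSimplex ℝ ι) (hy : y ∈ stdSimplex ℝ ι) :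
    l1 (x - y) ≤ 2 := by
  have := l1_sub_le x y
  rw [l1_of_mem_stdSimplex hx, l1_of_mem_stdSimplex hy] at this
  linarith

theorem abs_dotProduct_le {x y : ι → ℝ} {B : ℝ} (hy : ∀ i, |y i| ≤ B) :
    |x ⬝ᵥ y| ≤ l1 x * B := by
  rw [dotProduct, l1, Finset.sum_mul]
  refine (Finset.abs_sum_le_sum_abs _ _).trans (Finset.sum_le_sum fun i _ => ?_)
  rw [abs_mul]
  exact mul_le_mul_of_nonneg_left (hy i) (abs_nonneg _)

theorem dotProduct_mem_Icc {x y : ι → ℝ} {a b : ℝ} (hx : x ∈ stdSimplex ℝ ι)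
    (hy : ∀ i, y i ∈ Set.Icc a b) : x ⬝ᵥ y ∈ Set.Icc a b := by
  have h : ∀ c : ℝ, ∑ i, x i * c = c := fun c => by rw [← Finset.sum_mul, hx.2, one_mul]
  constructor
  · rw [← h a]
    exact Finset.sum_le_sum fun i _ => mul_le_mul_of_nonneg_left (hy i).1 (hx.1 i)
  · conv_rhs => rw [← h b]
    exact Finset.sum_le_sum fun i _ => mul_le_mul_of_nonneg_left (hy i).2 (hx.1 i)

variable [Fintype κ]

theorem l1_vecMul_le {x : ι → ℝ} {N : Matrix ι κ ℝ} {δ : ℝ} (hN : ∀ i, l1 (N i) ≤ δ) :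
    l1 (x ᵥ* N) ≤ l1 x * δ := by
  have : x ᵥ* N = ∑ i, x i • N i := by
    ext k
    simp [Matrix.vecMul, dotProduct]
  rw [this]
  refine (l1_sum_le _ _).trans ?_
  rw [l1, Finset.sum_mul]
  refine Finset.sum_le_sum fun i _ => ?_
  rw [l1_smul]
  exact mul_le_mul_of_nonneg_left (hN i) (abs_nonneg _)

/-- The distance of two mixtures `∑ p a • f a` of vectors of norm at most `1` is controlled by
the distance of the weights and the distances of the components. -/
theorem l1_mixture_sub_le {p p' : κ → ℝ} {f f' : κ → ι → ℝ} {δ : ℝ} (hp : p ∈ stdSimplex ℝ κ)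
    (hf : ∀ a, l1 (f a - f' a) ≤ δ) (hf' : ∀ a, l1 (f' a) ≤ 1) :
    l1 (∑ a, p a • f a - ∑ a, p' a • f' a) ≤ l1 (p - p') + δ := by
  have h : ∑ a, p a • f a - ∑ a, p' a • f' a
      = ∑ a, (p - p') a • f' a + ∑ a, p a • (f a - f' a) := by
    rw [← Finset.sum_sub_distrib, ← Finset.sum_add_distrib]
    refine Finset.sum_congr rfl fun a _ => ?_
    rw [Pi.sub_apply, sub_smul, smul_sub]
    abel
  rw [h]
  refine (l1_add_le _ _).trans (add_le_add ?_ ?_)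
  · refine (l1_sum_le _ _).trans (Finset.sum_le_sum fun a _ => ?_)
    rw [l1_smul]
    exact mul_le_of_le_one_right (abs_nonneg _) (hf' a)
  · refine (l1_sum_le _ _).trans ?_
    calc ∑ a, l1 (p a • (f a - f' a)) ≤ ∑ a, p a * δ := by
          refine Finset.sum_le_sum fun a _ => ?_
          rw [l1_smul, abs_of_nonneg (hp.1 a)]
          exact mul_le_mul_of_nonneg_left (hf a) (hp.1 a)
      _ = δ := by rw [← Finset.sum_mul, hp.2, one_mul]

/-- The scalar case of `l1_mixture_sub_le`. -/
theorem abs_dotProduct_sub_le {p p' f f' : κ → ℝ} {δ : ℝ} (hp : p ∈ stdSimplex ℝ κ)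
    (hf : ∀ a, |f a - f' a| ≤ δ) (hf' : ∀ a, |f' a| ≤ 1) :
    |p ⬝ᵥ f - p' ⬝ᵥ f'| ≤ l1 (p - p') + δ := by
  have := l1_mixture_sub_le (ι := Unit) (p := p) (p' := p') (f := fun a _ => f a)
    (f' := fun a _ => f' a) (δ := δ) hp (by simpa [l1] using hf) (by simpa [l1] using hf')
  simpa [l1, dotProduct] using this

end L1

/-! ### Mixing and stationary distributions -/

/-- The gap `1 - e^{-1/ω}` between `1` and the contraction factor of the mixing time `ω`. -/
noncomputable def gap (ω : ℝ) : ℝ := 1 - Real.exp (-1 / ω)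

theorem gap_pos {ω : ℝ} (hω : 0 < ω) : 0 < gap ω := by
  rw [gap, sub_pos, Real.exp_lt_one_iff]
  exact div_neg_of_neg_of_pos (by norm_num) hω

theorem gap_lt_one (ω : ℝ) : gap ω < 1 := by
  rw [gap]
  linarith [Real.exp_pos (-1 / ω)]

namespace MDP

theorem nonempty_state {S A₁ A₂ : Type*} [Fintype S] (G : MDP S A₁ A₂) : Nonempty S := by
  by_contra hS
  rw [not_nonempty_iff] at hS
  have := G.init.2.2
  simp at this

variable {S A₁ A₂ : Type*} [Fintype S] [Fintype A₂] (G : MDP S A₁ A₂)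

theorem actionKernel_mem (π₂ : Policy S A₂) (s : S) (a : A₁) :
    G.actionKernel π₂ s a ∈ stdSimplex ℝ S := by
  refine ⟨fun s' => Finset.sum_nonneg fun b _ =>
    mul_nonneg ((π₂ s).2.1 b) ((G.trans s a b).2.1 s'), ?_⟩
  simp only [actionKernel]
  rw [Finset.sum_comm]
  simp only [← Finset.mul_sum]
  rw [← (π₂ s).2.2]
  exact Finset.sum_congr rfl fun b _ => by rw [(G.trans s a b).2.2, mul_one]

theorem reward₁_mem (π₂ : Policy S A₂) (s : S) (a : A₁) :
    G.reward₁ π₂ s a ∈ Set.Icc (0 : ℝ) 1 :=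
  dotProduct_mem_Icc (π₂ s).2 fun b => G.reward_mem s a b

theorem abs_reward₁_le (π₂ : Policy S A₂) (s : S) (a : A₁) : |G.reward₁ π₂ s a| ≤ 1 :=
  abs_le.2 ⟨by linarith [(G.reward₁_mem π₂ s a).1], (G.reward₁_mem π₂ s a).2⟩

theorem l1_actionKernel_sub_le {π₂ π₂' : Policy S A₂} {δ₂ : ℝ}
    (h₂ : ∀ s, l1 ((π₂ s).1 - (π₂' s).1) ≤ δ₂)
    (s : S) (a : A₁) : l1 (G.actionKernel π₂ s a - G.actionKernel π₂' s a) ≤ δ₂ := by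
  have e : ∀ π : Policy S A₂, G.actionKernel π s a = ∑ b, (π s).1 b • (G.trans s a b).1 := by
    intro π
    ext s'
    simp [actionKernel]
  rw [e, e]
  refine (l1_mixture_sub_le (δ := 0) (π₂ s).2 (fun b => ?_) fun b => ?_).trans ?_
  · rw [sub_self, l1_zero]
  · exact (l1_of_mem_stdSimplex (G.trans s a b).2).le
  · rw [add_zero]
    exact h₂ s

theorem abs_reward₁_sub_le {π₂ π₂' : Policy S A₂} {δ₂ : ℝ}
    (h₂ : ∀ s, l1 ((π₂ s).1 - (π₂' s).1) ≤ δ₂)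
    (s : S) (a : A₁) : |G.reward₁ π₂ s a - G.reward₁ π₂' s a| ≤ δ₂ := by
  refine (abs_dotProduct_sub_le (δ := 0) (π₂ s).2 (fun b => ?_) fun b => ?_).trans ?_
  · rw [sub_self, abs_zero]
  · rw [abs_of_nonneg (G.reward_mem s a b).1]
    exact (G.reward_mem s a b).2
  · rw [add_zero]
    exact h₂ s

variable [Fintype A₁]

theorem kernel_apply_eq_sum (π₁ : Policy S A₁) (π₂ : Policy S A₂) (s : S) :
    G.kernel π₁ π₂ s = ∑ a, (π₁ s).1 a • G.actionKernel π₂ s a := by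
  ext s'
  simp [kernel]

theorem sum_kernel (π₁ : Policy S A₁) (π₂ : Policy S A₂) (s : S) :
    ∑ s', G.kernel π₁ π₂ s s' = 1 := by
  simp only [kernel]
  rw [Finset.sum_comm]
  simp only [← Finset.mul_sum, (G.actionKernel_mem π₂ s _).2, mul_one]
  exact (π₁ s).2.2

theorem stateReward_mem (π₁ : Policy S A₁) (π₂ : Policy S A₂) (s : S) :
    G.stateReward π₁ π₂ s ∈ Set.Icc (0 : ℝ) 1 :=
  dotProduct_mem_Icc (π₁ s).2 fun a => G.reward₁_mem π₂ s a

theorem abs_stateReward_le (π₁ : Policy S A₁) (π₂ : Policy S A₂) (s : S) :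
    |G.stateReward π₁ π₂ s| ≤ 1 :=
  abs_le.2 ⟨by linarith [(G.stateReward_mem π₁ π₂ s).1], (G.stateReward_mem π₁ π₂ s).2⟩

theorem stateDist_succ (π₁ : Policy S A₁) (π₂ : Policy S A₂) (d : S → ℝ) (k : ℕ) :
    G.stateDist π₁ π₂ d (k + 1) = G.stateDist π₁ π₂ d k ᵥ* G.kernel π₁ π₂ :=
  Function.iterate_succ_apply' _ _ _

theorem stateDist_succ' (π₁ : Policy S A₁) (π₂ : Policy S A₂) (d : S → ℝ) (k : ℕ) :
    G.stateDist π₁ π₂ d (k + 1) = G.stateDist π₁ π₂ (d ᵥ* G.kernel π₁ π₂) k :=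
  Function.iterate_succ_apply _ _ _

theorem stateDist_mem (π₁ : Policy S A₁) (π₂ : Policy S A₂) {d : S → ℝ}
    (hd : d ∈ stdSimplex ℝ S) (k : ℕ) : G.stateDist π₁ π₂ d k ∈ stdSimplex ℝ S := by
  induction k with
  | zero => exact hd
  | succ k ih =>
    rw [stateDist_succ]
    exact G.kernel_vecMul_mem π₁ π₂ ih

theorem stateDist_eq_sum (π₁ : Policy S A₁) (π₂ : Policy S A₂) {κ : Type*} (t : Finset κ)
    (c : κ → ℝ) (f : κ → S → ℝ) (k : ℕ) :
    G.stateDist π₁ π₂ (∑ i ∈ t, c i • f i) k = ∑ i ∈ t, c i • G.stateDist π₁ π₂ (f i) k := by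
  induction k with
  | zero => rfl
  | succ k ih =>
    simp only [stateDist_succ, ih]
    rw [Matrix.sum_vecMul]
    simp only [Matrix.smul_vecMul]

variable {G} {ω : ℝ}

/-- The contraction of `IsMixingTime`, extended from differences of distributions to all vectors
of total mass `0` by homogeneity. -/
theorem IsMixingTime.l1_vecMul_le (h : G.IsMixingTime ω) (π₁ : Policy S A₁) (π₂ : Policy S A₂)
    {x : S → ℝ} (hx : ∑ s, x s = 0) :
    l1 (x ᵥ* G.kernel π₁ π₂) ≤ (1 - gap ω) * l1 x := by
  have hg : 1 - gap ω = Real.exp (-1 / ω) := by rw [gap]; ring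
  rw [hg]
  have h1 : ∑ s, (x s)⁺ - ∑ s, (x s)⁻ = 0 := by
    rw [← Finset.sum_sub_distrib]
    simpa only [posPart_sub_negPart] using hx
  set p := ∑ s, (x s)⁺ with hp
  have hp' : ∑ s, (x s)⁻ = p := by linarith
  have hp0 : 0 ≤ p := Finset.sum_nonneg fun s _ => posPart_nonneg _
  rcases hp0.eq_or_lt with h0 | h0
  · have hx0 : x = 0 := by
      ext s
      have e1 := (Finset.sum_eq_zero_iff_of_nonneg fun s _ => posPart_nonneg (x s)).1
        (hp.symm.trans h0.symm) s (Finset.mem_univ s)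
      have e2 := (Finset.sum_eq_zero_iff_of_nonneg fun s _ => negPart_nonneg (x s)).1
        (hp'.trans h0.symm) s (Finset.mem_univ s)
      rw [← posPart_sub_negPart (x s), e1, e2]
      simp
    simp [hx0]
  · have hd : (fun s => p⁻¹ * (x s)⁺) ∈ stdSimplex ℝ S :=
      ⟨fun s => mul_nonneg (inv_nonneg.2 hp0) (posPart_nonneg _), by
        rw [← Finset.mul_sum, ← hp, inv_mul_cancel₀ h0.ne']⟩
    have hd' : (fun s => p⁻¹ * (x s)⁻) ∈ stdSimplex ℝ S :=
      ⟨fun s => mul_nonneg (inv_nonneg.2 hp0) (negPart_nonneg _), by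
        rw [← Finset.mul_sum, hp', inv_mul_cancel₀ h0.ne']⟩
    have hsub : x = p • ((fun s => p⁻¹ * (x s)⁺) - fun s => p⁻¹ * (x s)⁻) := by
      ext s
      simp only [Pi.smul_apply, Pi.sub_apply, smul_eq_mul]
      rw [← mul_sub, posPart_sub_negPart, mul_inv_cancel_left₀ h0.ne']
    have key := h π₁ π₂ _ hd _ hd'
    rw [hsub, Matrix.smul_vecMul, Matrix.sub_vecMul, l1_smul, l1_smul, mul_left_comm]
    exact mul_le_mul_of_nonneg_left key (abs_nonneg _)

theorem IsMixingTime.isStationary (h : G.IsMixingTime ω) (hω : 0 < ω) (π₁ : Policy S A₁)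
    (π₂ : Policy S A₂) : G.IsStationary π₁ π₂ (G.stationaryDist π₁ π₂) :=
  Classical.epsilon_spec (G.existsUnique_isStationary hω h π₁ π₂).exists

theorem IsMixingTime.stationaryDist_mem (h : G.IsMixingTime ω) (hω : 0 < ω) (π₁ : Policy S A₁)
    (π₂ : Policy S A₂) : G.stationaryDist π₁ π₂ ∈ stdSimplex ℝ S :=
  (h.isStationary hω π₁ π₂).1

theorem IsMixingTime.stationaryDist_vecMul (h : G.IsMixingTime ω) (hω : 0 < ω)
    (π₁ : Policy S A₁) (π₂ : Policy S A₂) :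
    G.stationaryDist π₁ π₂ ᵥ* G.kernel π₁ π₂ = G.stationaryDist π₁ π₂ :=
  (h.isStationary hω π₁ π₂).2.1

theorem IsMixingTime.avgReward_mem (h : G.IsMixingTime ω) (hω : 0 < ω) (π₁ : Policy S A₁)
    (π₂ : Policy S A₂) : G.avgReward π₁ π₂ ∈ Set.Icc (0 : ℝ) 1 :=
  dotProduct_mem_Icc (h.stationaryDist_mem hω π₁ π₂) fun s => G.stateReward_mem π₁ π₂ s

theorem IsMixingTime.l1_stateDist_sub_le (h : G.IsMixingTime ω) (hω : 0 < ω)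
    (π₁ : Policy S A₁) (π₂ : Policy S A₂) {d : S → ℝ} (hd : d ∈ stdSimplex ℝ S) (k : ℕ) :
    l1 (G.stateDist π₁ π₂ d k - G.stationaryDist π₁ π₂) ≤ 2 * (1 - gap ω) ^ k := by
  induction k with
  | zero =>
    rw [pow_zero, mul_one]
    exact l1_sub_le_two hd (h.stationaryDist_mem hω π₁ π₂)
  | succ k ih =>
    have h0 : ∑ s, (G.stateDist π₁ π₂ d k - G.stationaryDist π₁ π₂) s = 0 := by
      simp only [Pi.sub_apply]
      rw [Finset.sum_sub_distrib, (G.stateDist_mem π₁ π₂ hd k).2,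
        (h.stationaryDist_mem hω π₁ π₂).2, sub_self]
    have h1 := h.l1_vecMul_le π₁ π₂ h0
    rw [Matrix.sub_vecMul, h.stationaryDist_vecMul hω, ← stateDist_succ] at h1
    refine h1.trans ?_
    rw [pow_succ']
    nlinarith [gap_lt_one ω]

/-! ### Perturbation of the policies -/

section Perturbation

variable {π₁ π₁' : Policy S A₁} {π₂ π₂' : Policy S A₂} {δ₁ δ₂ : ℝ}

theorem l1_kernel_sub_le (G : MDP S A₁ A₂) (h₁ : ∀ s, l1 ((π₁ s).1 - (π₁' s).1) ≤ δ₁)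
    (h₂ : ∀ s, l1 ((π₂ s).1 - (π₂' s).1) ≤ δ₂) (s : S) :
    l1 ((G.kernel π₁ π₂ - G.kernel π₁' π₂') s) ≤ δ₁ + δ₂ := by
  have e : (G.kernel π₁ π₂ - G.kernel π₁' π₂') s = G.kernel π₁ π₂ s - G.kernel π₁' π₂' s := rfl
  rw [e, kernel_apply_eq_sum, kernel_apply_eq_sum]
  refine (l1_mixture_sub_le (π₁ s).2 (fun a => G.l1_actionKernel_sub_le h₂ s a) fun a => ?_).trans
    (by linarith [h₁ s])
  exact (l1_of_mem_stdSimplex (G.actionKernel_mem π₂' s a)).le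

theorem abs_stateReward_sub_le (G : MDP S A₁ A₂) (h₁ : ∀ s, l1 ((π₁ s).1 - (π₁' s).1) ≤ δ₁)
    (h₂ : ∀ s, l1 ((π₂ s).1 - (π₂' s).1) ≤ δ₂) (s : S) :
    |G.stateReward π₁ π₂ s - G.stateReward π₁' π₂' s| ≤ δ₁ + δ₂ :=
  (abs_dotProduct_sub_le (π₁ s).2 (fun a => G.abs_reward₁_sub_le h₂ s a)
    fun a => G.abs_reward₁_le π₂' s a).trans (by linarith [h₁ s])

theorem IsMixingTime.l1_stationaryDist_sub_le (h : G.IsMixingTime ω) (hω : 0 < ω)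
    (h₁ : ∀ s, l1 ((π₁ s).1 - (π₁' s).1) ≤ δ₁) (h₂ : ∀ s, l1 ((π₂ s).1 - (π₂' s).1) ≤ δ₂) :
    l1 (G.stationaryDist π₁ π₂ - G.stationaryDist π₁' π₂') ≤ (δ₁ + δ₂) / gap ω := by
  set d := G.stationaryDist π₁ π₂ with hd
  set d' := G.stationaryDist π₁' π₂' with hd'
  have hdm : d ∈ stdSimplex ℝ S := h.stationaryDist_mem hω π₁ π₂
  have hdm' : d' ∈ stdSimplex ℝ S := h.stationaryDist_mem hω π₁' π₂'
  have e : d - d' = (d - d') ᵥ* G.kernel π₁ π₂ + d' ᵥ* (G.kernel π₁ π₂ - G.kernel π₁' π₂') := by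
    rw [Matrix.sub_vecMul, Matrix.vecMul_sub, hd, hd', h.stationaryDist_vecMul hω,
      h.stationaryDist_vecMul hω]
    abel
  have h0 : ∑ s, (d - d') s = 0 := by
    simp only [Pi.sub_apply]
    rw [Finset.sum_sub_distrib, hdm.2, hdm'.2, sub_self]
  have e1 := h.l1_vecMul_le π₁ π₂ h0
  have e2 := TwoAgent.l1_vecMul_le (x := d') (G.l1_kernel_sub_le h₁ h₂)
  rw [l1_of_mem_stdSimplex hdm', one_mul] at e2
  have e3 := l1_add_le ((d - d') ᵥ* G.kernel π₁ π₂) (d' ᵥ* (G.kernel π₁ π₂ - G.kernel π₁' π₂'))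
  rw [← e] at e3
  rw [le_div_iff₀ (gap_pos hω)]
  linarith

theorem IsMixingTime.abs_avgReward_sub_le (h : G.IsMixingTime ω) (hω : 0 < ω)
    (h₁ : ∀ s, l1 ((π₁ s).1 - (π₁' s).1) ≤ δ₁) (h₂ : ∀ s, l1 ((π₂ s).1 - (π₂' s).1) ≤ δ₂) :
    |G.avgReward π₁ π₂ - G.avgReward π₁' π₂'| ≤ (δ₁ + δ₂) / gap ω + (δ₁ + δ₂) :=
  (abs_dotProduct_sub_le (h.stationaryDist_mem hω π₁ π₂) (G.abs_stateReward_sub_le h₁ h₂)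
    (G.abs_stateReward_le π₁' π₂')).trans
    (add_le_add (h.l1_stationaryDist_sub_le hω h₁ h₂) le_rfl)

end Perturbation

variable (G)

/-! ### The bias of an initial distribution and the `Q`-values -/

/-- The expected total excess of the rewards over the average reward, when the initial state has
the distribution `ν`. A `Q`-value is the excess of the first round plus the bias of the law of
the second state. -/
noncomputable def bias (π₁ : Policy S A₁) (π₂ : Policy S A₂) (ν : S → ℝ) : ℝ :=
  ∑' k : ℕ, (G.stateDist π₁ π₂ ν k ⬝ᵥ G.stateReward π₁ π₂ - G.avgReward π₁ π₂)

/-- The accumulated deviation of the state distributions of the first `n` rounds from the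
stationary distribution; its pairing with the rewards is a partial sum of the bias. -/
noncomputable def deviation (π₁ : Policy S A₁) (π₂ : Policy S A₂) (ν : S → ℝ) (n : ℕ) : S → ℝ :=
  ∑ k ∈ Finset.range n, (G.stateDist π₁ π₂ ν k - G.stationaryDist π₁ π₂)

variable {G}

theorem IsMixingTime.abs_excess_le (h : G.IsMixingTime ω) (hω : 0 < ω) (π₁ : Policy S A₁)
    (π₂ : Policy S A₂) {ν : S → ℝ} (hν : ν ∈ stdSimplex ℝ S) (k : ℕ) :
    |G.stateDist π₁ π₂ ν k ⬝ᵥ G.stateReward π₁ π₂ - G.avgReward π₁ π₂| ≤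
      2 * (1 - gap ω) ^ k := by
  rw [avgReward, ← sub_dotProduct]
  refine (abs_dotProduct_le (G.abs_stateReward_le π₁ π₂)).trans ?_
  rw [mul_one]
  exact h.l1_stateDist_sub_le hω π₁ π₂ hν k

theorem hasSum_two_mul_geometric_gap (hω : 0 < ω) :
    HasSum (fun k : ℕ => 2 * (1 - gap ω) ^ k) (2 / gap ω) := by
  have := (hasSum_geometric_of_lt_one (r := 1 - gap ω) (by linarith [gap_lt_one ω])
    (by linarith [gap_pos hω])).mul_left 2
  rwa [sub_sub_cancel, ← div_eq_mul_inv] at this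

theorem IsMixingTime.hasSum_bias (h : G.IsMixingTime ω) (hω : 0 < ω) (π₁ : Policy S A₁)
    (π₂ : Policy S A₂) {ν : S → ℝ} (hν : ν ∈ stdSimplex ℝ S) :
    HasSum (fun k : ℕ => G.stateDist π₁ π₂ ν k ⬝ᵥ G.stateReward π₁ π₂ - G.avgReward π₁ π₂)
      (G.bias π₁ π₂ ν) :=
  (Summable.of_norm_bounded (hasSum_two_mul_geometric_gap hω).summable
    fun k => h.abs_excess_le hω π₁ π₂ hν k).hasSum

theorem IsMixingTime.abs_bias_le (h : G.IsMixingTime ω) (hω : 0 < ω) (π₁ : Policy S A₁)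
    (π₂ : Policy S A₂) {ν : S → ℝ} (hν : ν ∈ stdSimplex ℝ S) :
    |G.bias π₁ π₂ ν| ≤ 2 / gap ω := by
  rw [bias, ← Real.norm_eq_abs]
  exact tsum_of_norm_bounded (hasSum_two_mul_geometric_gap hω) fun k => h.abs_excess_le hω π₁ π₂ hν k

theorem IsMixingTime.bias_eq (h : G.IsMixingTime ω) (hω : 0 < ω) (π₁ : Policy S A₁)
    (π₂ : Policy S A₂) {ν : S → ℝ} (hν : ν ∈ stdSimplex ℝ S) :
    G.bias π₁ π₂ ν = ν ⬝ᵥ G.stateReward π₁ π₂ - G.avgReward π₁ π₂ +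
      G.bias π₁ π₂ (ν ᵥ* G.kernel π₁ π₂) := by
  rw [bias, (h.hasSum_bias hω π₁ π₂ hν).summable.tsum_eq_zero_add, bias]
  simp only [stateDist_succ']
  rfl

theorem IsMixingTime.bias_sum (h : G.IsMixingTime ω) (hω : 0 < ω) (π₁ : Policy S A₁)
    (π₂ : Policy S A₂) {κ : Type*} [Fintype κ] {c : κ → ℝ} (hc : c ∈ stdSimplex ℝ κ)
    {f : κ → S → ℝ} (hf : ∀ i, f i ∈ stdSimplex ℝ S) :
    G.bias π₁ π₂ (∑ i, c i • f i) = ∑ i, c i * G.bias π₁ π₂ (f i) := by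
  refine HasSum.tsum_eq ?_
  refine (hasSum_sum (s := Finset.univ)
    fun i _ => (h.hasSum_bias hω π₁ π₂ (hf i)).mul_left (c i)).congr_fun fun k => ?_
  simp only [mul_sub, Finset.sum_sub_distrib]
  rw [← Finset.sum_mul, hc.2, one_mul, stateDist_eq_sum, sum_dotProduct]
  simp only [smul_dotProduct, smul_eq_mul]

theorem IsMixingTime.qValue_eq (h : G.IsMixingTime ω) (hω : 0 < ω) (π₁ : Policy S A₁)
    (π₂ : Policy S A₂) (s : S) (a : A₁) :
    G.qValue π₁ π₂ s a = G.reward₁ π₂ s a - G.avgReward π₁ π₂ +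
      G.bias π₁ π₂ (G.actionKernel π₂ s a) := by
  have hs := (h.hasSum_bias hω π₁ π₂ (G.actionKernel_mem π₂ s a)).summable
  rw [qValue, Summable.tsum_eq_zero_add]
  · rfl
  · exact (summable_nat_add_iff 1).1 hs

theorem IsMixingTime.abs_qValue_le (h : G.IsMixingTime ω) (hω : 0 < ω) (π₁ : Policy S A₁)
    (π₂ : Policy S A₂) (s : S) (a : A₁) : |G.qValue π₁ π₂ s a| ≤ 3 / gap ω := by
  have h1 := h.abs_bias_le hω π₁ π₂ (G.actionKernel_mem π₂ s a)
  have h2 := G.reward₁_mem π₂ s a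
  have h3 := h.avgReward_mem hω π₁ π₂
  have h4 : (1 : ℝ) ≤ 1 / gap ω := by
    rw [le_div_iff₀ (gap_pos hω)]
    linarith [gap_lt_one ω]
  have h5 : 3 / gap ω = 1 / gap ω + 2 / gap ω := by ring
  rw [abs_le] at h1
  rw [h.qValue_eq hω, h5, abs_le]
  constructor <;> linarith [h2.1, h2.2, h3.1, h3.2, h1.1, h1.2]

theorem IsMixingTime.sum_mul_qValue (h : G.IsMixingTime ω) (hω : 0 < ω) (π π₁ : Policy S A₁)
    (π₂ : Policy S A₂) (s : S) :
    ∑ a, (π s).1 a * G.qValue π₁ π₂ s a = G.stateReward π π₂ s - G.avgReward π₁ π₂ +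
      G.bias π₁ π₂ (G.kernel π π₂ s) := by
  simp only [h.qValue_eq hω, mul_add, mul_sub, Finset.sum_add_distrib, Finset.sum_sub_distrib]
  rw [← Finset.sum_mul, (π s).2.2, one_mul, kernel_apply_eq_sum,
    h.bias_sum hω π₁ π₂ (π s).2 fun a => G.actionKernel_mem π₂ s a]
  rfl

theorem kernel_mem (G : MDP S A₁ A₂) (π₁ : Policy S A₁) (π₂ : Policy S A₂) (s : S) :
    G.kernel π₁ π₂ s ∈ stdSimplex ℝ S :=
  ⟨fun s' => Finset.sum_nonneg fun a _ =>
    mul_nonneg ((π₁ s).2.1 a) ((G.actionKernel_mem π₂ s a).1 s'), G.sum_kernel π₁ π₂ s⟩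

theorem IsMixingTime.sum_mul_sum_mul_qValue (h : G.IsMixingTime ω) (hω : 0 < ω)
    (π π₁ : Policy S A₁) (π₂ : Policy S A₂) {d : S → ℝ} (hd : d ∈ stdSimplex ℝ S) :
    ∑ s, d s * ∑ a, (π s).1 a * G.qValue π₁ π₂ s a = d ⬝ᵥ G.stateReward π π₂ -
      G.avgReward π₁ π₂ + G.bias π₁ π₂ (d ᵥ* G.kernel π π₂) := by
  have e : d ᵥ* G.kernel π π₂ = ∑ s, d s • G.kernel π π₂ s := by
    ext k
    simp [Matrix.vecMul, dotProduct]
  rw [e, h.bias_sum hω π₁ π₂ hd (G.kernel_mem π π₂)]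
  simp only [h.sum_mul_qValue hω, mul_add, mul_sub, Finset.sum_add_distrib,
    Finset.sum_sub_distrib]
  rw [← Finset.sum_mul, hd.2, one_mul]
  rfl

/-- The performance difference lemma: the gain in average reward from deviating to `π` is the
expected gain in `Q`-value under the stationary distribution of the deviation. -/
theorem IsMixingTime.avgReward_sub_eq (h : G.IsMixingTime ω) (hω : 0 < ω)
    (π π₁ : Policy S A₁) (π₂ : Policy S A₂) :
    G.avgReward π π₂ - G.avgReward π₁ π₂ = ∑ s, G.stationaryDist π π₂ s *
      ∑ a, ((π s).1 a - (π₁ s).1 a) * G.qValue π₁ π₂ s a := by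
  have hd := h.stationaryDist_mem hω π π₂
  have h1 := h.sum_mul_sum_mul_qValue hω π π₁ π₂ hd
  have h2 := h.sum_mul_sum_mul_qValue hω π₁ π₁ π₂ hd
  rw [← h.bias_eq hω π₁ π₂ hd] at h2
  rw [h.stationaryDist_vecMul hω] at h1
  simp only [sub_mul, Finset.sum_sub_distrib, mul_sub]
  rw [h1, h2]
  simp only [avgReward]
  ring

/-! ### Lipschitz dependence of the `Q`-values on the policies -/

theorem IsMixingTime.sum_deviation (h : G.IsMixingTime ω) (hω : 0 < ω) (π₁ : Policy S A₁)
    (π₂ : Policy S A₂) {ν : S → ℝ} (hν : ν ∈ stdSimplex ℝ S) (n : ℕ) :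
    ∑ s, G.deviation π₁ π₂ ν n s = 0 := by
  simp only [deviation, Finset.sum_apply, Pi.sub_apply]
  rw [Finset.sum_comm]
  refine Finset.sum_eq_zero fun k _ => ?_
  rw [Finset.sum_sub_distrib, (G.stateDist_mem π₁ π₂ hν k).2,
    (h.stationaryDist_mem hω π₁ π₂).2, sub_self]

theorem IsMixingTime.l1_deviation_le (h : G.IsMixingTime ω) (hω : 0 < ω) (π₁ : Policy S A₁)
    (π₂ : Policy S A₂) {ν : S → ℝ} (hν : ν ∈ stdSimplex ℝ S) (n : ℕ) :
    l1 (G.deviation π₁ π₂ ν n) ≤ 2 / gap ω := by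
  refine (l1_sum_le _ _).trans ((Finset.sum_le_sum fun k _ =>
    h.l1_stateDist_sub_le hω π₁ π₂ hν k).trans ?_)
  refine sum_le_hasSum _ (fun k _ => ?_) (hasSum_two_mul_geometric_gap hω)
  have := gap_lt_one ω
  have : 0 ≤ 1 - gap ω := by linarith
  positivity

theorem IsMixingTime.deviation_succ (h : G.IsMixingTime ω) (hω : 0 < ω) (π₁ : Policy S A₁)
    (π₂ : Policy S A₂) (ν : S → ℝ) (n : ℕ) :
    G.deviation π₁ π₂ ν (n + 1) =
      ν - G.stationaryDist π₁ π₂ + G.deviation π₁ π₂ ν n ᵥ* G.kernel π₁ π₂ := by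
  rw [deviation, Finset.sum_range_succ', deviation, Matrix.sum_vecMul, add_comm]
  congr 1
  refine Finset.sum_congr rfl fun k _ => ?_
  rw [Matrix.sub_vecMul, h.stationaryDist_vecMul hω, stateDist_succ]

theorem deviation_dotProduct (G : MDP S A₁ A₂) (π₁ : Policy S A₁) (π₂ : Policy S A₂)
    (ν : S → ℝ) (n : ℕ) :
    G.deviation π₁ π₂ ν n ⬝ᵥ G.stateReward π₁ π₂ = ∑ k ∈ Finset.range n,
      (G.stateDist π₁ π₂ ν k ⬝ᵥ G.stateReward π₁ π₂ - G.avgReward π₁ π₂) := by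
  rw [deviation, sum_dotProduct]
  simp only [sub_dotProduct, avgReward]

section Perturbation

variable {π₁ π₁' : Policy S A₁} {π₂ π₂' : Policy S A₂} {δ₁ δ₂ : ℝ}

/-- The recursion `deviation_succ` contracts, so the distance of the deviations of two pairs of
policies stays bounded in the number of rounds. -/
theorem IsMixingTime.l1_deviation_sub_le (h : G.IsMixingTime ω) (hω : 0 < ω)
    (h₁ : ∀ s, l1 ((π₁ s).1 - (π₁' s).1) ≤ δ₁) (h₂ : ∀ s, l1 ((π₂ s).1 - (π₂' s).1) ≤ δ₂)
    {ν ν' : S → ℝ} (hν : ν ∈ stdSimplex ℝ S) (hν' : ν' ∈ stdSimplex ℝ S)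
    (hδ : 0 ≤ δ₁ + δ₂) (n : ℕ) :
    l1 (G.deviation π₁ π₂ ν n - G.deviation π₁' π₂' ν' n) ≤
      (l1 (ν - ν') + 3 * (δ₁ + δ₂) / gap ω) / gap ω := by
  have hg := gap_pos hω
  induction n with
  | zero =>
    simp only [deviation, Finset.range_zero, Finset.sum_empty, sub_self, l1_zero]
    have := l1_nonneg (ν - ν')
    positivity
  | succ n ih =>
    set z := G.deviation π₁ π₂ ν n
    set z' := G.deviation π₁' π₂' ν' n with hz'
    have e : G.deviation π₁ π₂ ν (n + 1) - G.deviation π₁' π₂' ν' (n + 1) =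
        ((ν - ν') - (G.stationaryDist π₁ π₂ - G.stationaryDist π₁' π₂')) +
        ((z - z') ᵥ* G.kernel π₁ π₂ + z' ᵥ* (G.kernel π₁ π₂ - G.kernel π₁' π₂')) := by
      rw [h.deviation_succ hω, h.deviation_succ hω, Matrix.sub_vecMul, Matrix.vecMul_sub]
      abel
    have h0 : ∑ s, (z - z') s = 0 := by
      simp only [Pi.sub_apply]
      rw [Finset.sum_sub_distrib, h.sum_deviation hω _ _ hν, h.sum_deviation hω _ _ hν',
        sub_self]
    have e1 := h.l1_vecMul_le π₁ π₂ h0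
    have e2 := TwoAgent.l1_vecMul_le (x := z') (G.l1_kernel_sub_le h₁ h₂)
    have e3 := mul_le_mul_of_nonneg_right (h.l1_deviation_le hω π₁' π₂' hν' n) hδ
    have e4 := h.l1_stationaryDist_sub_le hω h₁ h₂
    have e5 := l1_sub_le (ν - ν') (G.stationaryDist π₁ π₂ - G.stationaryDist π₁' π₂')
    have e6 := l1_add_le ((z - z') ᵥ* G.kernel π₁ π₂)
      (z' ᵥ* (G.kernel π₁ π₂ - G.kernel π₁' π₂'))
    have e7 := mul_le_mul_of_nonneg_left ih (by linarith [gap_lt_one ω] : 0 ≤ 1 - gap ω)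
    rw [e]
    refine (l1_add_le _ _).trans ?_
    calc _ ≤ (l1 (ν - ν') + 3 * (δ₁ + δ₂) / gap ω) + (1 - gap ω) *
          ((l1 (ν - ν') + 3 * (δ₁ + δ₂) / gap ω) / gap ω) := by
          have : 3 * (δ₁ + δ₂) / gap ω = (δ₁ + δ₂) / gap ω + 2 / gap ω * (δ₁ + δ₂) := by ring
          linarith
      _ = _ := by field_simp; ring

theorem IsMixingTime.abs_bias_sub_le (h : G.IsMixingTime ω) (hω : 0 < ω)
    (h₁ : ∀ s, l1 ((π₁ s).1 - (π₁' s).1) ≤ δ₁) (h₂ : ∀ s, l1 ((π₂ s).1 - (π₂' s).1) ≤ δ₂)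
    {ν ν' : S → ℝ} (hν : ν ∈ stdSimplex ℝ S) (hν' : ν' ∈ stdSimplex ℝ S)
    (hδ : 0 ≤ δ₁ + δ₂) :
    |G.bias π₁ π₂ ν - G.bias π₁' π₂' ν'| ≤
      (l1 (ν - ν') + 3 * (δ₁ + δ₂) / gap ω) / gap ω + 2 / gap ω * (δ₁ + δ₂) := by
  have t := ((h.hasSum_bias hω π₁ π₂ hν).tendsto_sum_nat.sub
    (h.hasSum_bias hω π₁' π₂' hν').tendsto_sum_nat).abs
  refine le_of_tendsto' t fun n => ?_
  rw [← deviation_dotProduct, ← deviation_dotProduct]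
  set z := G.deviation π₁ π₂ ν n
  set z' := G.deviation π₁' π₂' ν' n with hz'
  have e : z ⬝ᵥ G.stateReward π₁ π₂ - z' ⬝ᵥ G.stateReward π₁' π₂' =
      (z - z') ⬝ᵥ G.stateReward π₁ π₂ +
        z' ⬝ᵥ (G.stateReward π₁ π₂ - G.stateReward π₁' π₂') := by
    rw [sub_dotProduct, dotProduct_sub]
    ring
  rw [e]
  refine (abs_add_le _ _).trans (add_le_add ?_ ?_)
  · refine (abs_dotProduct_le (G.abs_stateReward_le π₁ π₂)).trans ?_
    rw [mul_one]
    exact h.l1_deviation_sub_le hω h₁ h₂ hν hν' hδ n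
  · refine (abs_dotProduct_le (G.abs_stateReward_sub_le h₁ h₂)).trans ?_
    exact mul_le_mul_of_nonneg_right (h.l1_deviation_le hω π₁' π₂' hν' n) hδ

theorem IsMixingTime.abs_qValue_sub_le (h : G.IsMixingTime ω) (hω : 0 < ω)
    (h₁ : ∀ s, l1 ((π₁ s).1 - (π₁' s).1) ≤ δ₁) (h₂ : ∀ s, l1 ((π₂ s).1 - (π₂' s).1) ≤ δ₂)
    (hδ₁ : 0 ≤ δ₁) (hδ₂ : 0 ≤ δ₂) (s : S) (a : A₁) :
    |G.qValue π₁ π₂ s a - G.qValue π₁' π₂' s a| ≤ 9 / gap ω ^ 2 * (δ₁ + δ₂) := by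
  have hg := gap_pos hω
  set Δ := δ₁ + δ₂ with hΔ
  have hΔ0 : 0 ≤ Δ := add_nonneg hδ₁ hδ₂
  have e1 := G.abs_reward₁_sub_le h₂ s a
  have e2 := h.abs_avgReward_sub_le hω h₁ h₂
  have e3 := h.abs_bias_sub_le hω h₁ h₂ (G.actionKernel_mem π₂ s a)
    (G.actionKernel_mem π₂' s a) hΔ0
  have e4 := G.l1_actionKernel_sub_le h₂ s a
  rw [h.qValue_eq hω, h.qValue_eq hω]
  have hb : (l1 (G.actionKernel π₂ s a - G.actionKernel π₂' s a) + 3 * Δ / gap ω) / gap ω ≤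
      (Δ + 3 * Δ / gap ω) / gap ω := by
    gcongr
    linarith
  -- every term is at most a multiple of `Δ / gap²`, because `gap ≤ 1`
  have hi : 1 ≤ 1 / gap ω := by
    rw [le_div_iff₀ hg]
    linarith [gap_lt_one ω]
  have hc : Δ + (Δ / gap ω + Δ) + ((Δ + 3 * Δ / gap ω) / gap ω + 2 / gap ω * Δ) ≤
      9 / gap ω ^ 2 * Δ := by
    have e : 9 / gap ω ^ 2 * Δ -
        (Δ + (Δ / gap ω + Δ) + ((Δ + 3 * Δ / gap ω) / gap ω + 2 / gap ω * Δ)) =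
        Δ * ((1 / gap ω - 1) * (6 * (1 / gap ω) + 2)) := by
      field_simp
      ring
    have : 0 ≤ Δ * ((1 / gap ω - 1) * (6 * (1 / gap ω) + 2)) :=
      mul_nonneg hΔ0 (mul_nonneg (by linarith) (by linarith))
    linarith
  rw [abs_le] at e1 e2 e3 ⊢
  constructor <;> linarith [e1.1, e1.2, e2.1, e2.2, e3.1, e3.2]

end Perturbation

end MDP

/-! ### Optimistic follow-the-regularized-leader on the simplex -/

section Regularizer

variable {A : Type*} [Fintype A] {R : (A → ℝ) → ℝ}

theorem IsRegularizer.convexOn (hR : IsRegularizer R) : ConvexOn ℝ (stdSimplex ℝ A) R := by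
  refine ⟨convex_stdSimplex ℝ A, fun x hx y hy a b ha hb hab => ?_⟩
  refine (hR x hx y hy a b ha hb hab).trans (sub_le_self _ ?_)
  positivity

theorem IsRegularizer.bddAbove_image (hR : IsRegularizer R) :
    BddAbove (R '' stdSimplex ℝ A) := by
  classical
  refine ⟨∑ i, |R (Pi.single i 1)|, ?_⟩
  rintro _ ⟨x, hx, rfl⟩
  have e : x = ∑ i, x i • (Pi.single i 1 : A → ℝ) := by
    ext j
    simp [Pi.single_apply]
  have h := hR.convexOn.map_sum_le (t := Finset.univ) (w := x)
    (p := fun i => (Pi.single i 1 : A → ℝ)) (fun i _ => hx.1 i) hx.2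
    fun i _ => single_mem_stdSimplex ℝ i
  rw [← e] at h
  refine h.trans (Finset.sum_le_sum fun i _ => ?_)
  have hi : x i ≤ 1 := by
    rw [← hx.2]
    exact Finset.single_le_sum (fun j _ => hx.1 j) (Finset.mem_univ i)
  rw [smul_eq_mul]
  nlinarith [le_abs_self (R (Pi.single i 1)), abs_nonneg (R (Pi.single i 1)), hx.1 i]

/-- A convex function on the simplex is bounded below: the barycenter is a convex combination of
any given point, with the fixed weight `1 / (n + 1)`, and another point of the simplex. -/
theorem IsRegularizer.bddBelow_image (hR : IsRegularizer R) :
    BddBelow (R '' stdSimplex ℝ A) := by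
  rcases isEmpty_or_nonempty A with hA | hA
  · refine ⟨0, ?_⟩
    rintro _ ⟨x, hx, rfl⟩
    have := hx.2
    simp at this
  obtain ⟨B, hB⟩ := hR.bddAbove_image
  have hn : (0 : ℝ) < Fintype.card A := by exact_mod_cast Fintype.card_pos
  set n : ℝ := (Fintype.card A : ℝ) with hn'
  set z : A → ℝ := fun _ => 1 / n with hz
  refine ⟨(n + 1) * R z - n * B, ?_⟩
  rintro _ ⟨x, hx, rfl⟩
  set y : A → ℝ := fun i => (n + 1) / n * (1 / n - x i / (n + 1)) with hy
  have hxy : y ∈ stdSimplex ℝ A := by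
    constructor
    · intro i
      have hi : x i ≤ 1 := by
        rw [← hx.2]
        exact Finset.single_le_sum (fun j _ => hx.1 j) (Finset.mem_univ i)
      have h1 : x i / (n + 1) ≤ 1 / n :=
        div_le_div₀ zero_le_one hi hn (by linarith)
      have h2 : 0 ≤ 1 / n - x i / (n + 1) := by linarith
      change 0 ≤ (n + 1) / n * (1 / n - x i / (n + 1))
      positivity
    · simp only [hy]
      rw [← Finset.mul_sum, Finset.sum_sub_distrib, ← Finset.sum_div (f := x), hx.2,
        Finset.sum_const, Finset.card_univ, nsmul_eq_mul, ← hn']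
      field_simp
      ring
  have e : (1 / (n + 1)) • x + (n / (n + 1)) • y = z := by
    ext i
    simp only [hy, hz, Pi.add_apply, Pi.smul_apply, smul_eq_mul]
    field_simp
    ring
  have h := hR.convexOn.2 hx hxy (by positivity : 0 ≤ 1 / (n + 1))
    (by positivity : 0 ≤ n / (n + 1)) (by field_simp; ring)
  rw [e, smul_eq_mul, smul_eq_mul] at h
  have hyB : R y ≤ B := hB ⟨y, hxy, rfl⟩
  have h2 : (n + 1) * R z ≤ R x + n * R y := by
    have := mul_le_mul_of_nonneg_left h (by positivity : 0 ≤ n + 1)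
    calc (n + 1) * R z ≤ _ := this
      _ = _ := by field_simp
  nlinarith

theorem IsRegularizer.sub_le_range (hR : IsRegularizer R) {x y : A → ℝ}
    (hx : x ∈ stdSimplex ℝ A) (hy : y ∈ stdSimplex ℝ A) : R x - R y ≤ regularizerRange R :=
  sub_le_sub (le_csSup hR.bddAbove_image ⟨x, hx, rfl⟩) (csInf_le hR.bddBelow_image ⟨y, hy, rfl⟩)

theorem IsRegularizer.range_nonneg (hR : IsRegularizer R) {x : A → ℝ}
    (hx : x ∈ stdSimplex ℝ A) : 0 ≤ regularizerRange R := by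
  rw [← sub_self (R x)]
  exact hR.sub_le_range hx hx

variable {ε : ℝ} {g g' w w' v : A → ℝ}

/-- The regularized objective is `1/ε`-strongly concave, so it falls off quadratically from its
maximizer. -/
theorem IsRegularizer.add_sq_le_of_isMaxOn (hR : IsRegularizer R) (hε : 0 < ε)
    (hw : w ∈ stdSimplex ℝ A) (hv : v ∈ stdSimplex ℝ A)
    (hmax : IsMaxOn (fun x => g ⬝ᵥ x - R x / ε) (stdSimplex ℝ A) w) :
    g ⬝ᵥ v - R v / ε + l1 (w - v) ^ 2 / (2 * ε) ≤ g ⬝ᵥ w - R w / ε := by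
  -- maximality against `(1 - b) w + b v`, divided by `b`, in the limit `b → 0`
  have key : ∀ b ∈ Set.Ioo (0 : ℝ) 1,
      g ⬝ᵥ v - R v / ε + (1 - b) * (l1 (w - v) ^ 2 / (2 * ε)) ≤ g ⬝ᵥ w - R w / ε := by
    intro b hb
    have h1 := hR w hw v hv (1 - b) b (by linarith [hb.2]) hb.1.le (by ring)
    have hm : (1 - b) • w + b • v ∈ stdSimplex ℝ A :=
      convex_stdSimplex ℝ A hw hv (by linarith [hb.2]) hb.1.le (by ring)
    have h2 : g ⬝ᵥ ((1 - b) • w + b • v) - R ((1 - b) • w + b • v) / ε ≤ g ⬝ᵥ w - R w / ε :=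
      hmax hm
    rw [dotProduct_add, dotProduct_smul, dotProduct_smul, smul_eq_mul, smul_eq_mul] at h2
    have h3 := div_le_div_of_nonneg_right h1 hε.le
    have e : ∑ i, |w i - v i| = l1 (w - v) := rfl
    rw [e] at h3
    have e2 : ((1 - b) * R w + b * R v - (1 - b) * b / 2 * l1 (w - v) ^ 2) / ε =
        (1 - b) * (R w / ε) + b * (R v / ε) - b * ((1 - b) * (l1 (w - v) ^ 2 / (2 * ε))) := by
      field_simp
    rw [e2] at h3
    refine le_of_mul_le_mul_left ?_ hb.1
    linarith
  have t : Filter.Tendsto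
      (fun b : ℝ => g ⬝ᵥ v - R v / ε + (1 - b) * (l1 (w - v) ^ 2 / (2 * ε))) (𝓝[>] 0)
      (𝓝 (g ⬝ᵥ v - R v / ε + (1 - 0) * (l1 (w - v) ^ 2 / (2 * ε)))) := by
    refine Filter.Tendsto.mono_left ?_ nhdsWithin_le_nhds
    exact Continuous.tendsto (by fun_prop) 0
  rw [sub_zero, one_mul] at t
  exact le_of_tendsto t (Filter.mem_of_superset (Ioo_mem_nhdsGT one_pos) key)

/-- The maximizer of the regularized objective is `ε`-Lipschitz in the linear term. -/
theorem IsRegularizer.l1_sub_le_of_isMaxOn (hR : IsRegularizer R) (hε : 0 < ε)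
    (hw : w ∈ stdSimplex ℝ A) (hw' : w' ∈ stdSimplex ℝ A)
    (hmax : IsMaxOn (fun x => g ⬝ᵥ x - R x / ε) (stdSimplex ℝ A) w)
    (hmax' : IsMaxOn (fun x => g' ⬝ᵥ x - R x / ε) (stdSimplex ℝ A) w')
    {B : ℝ} (hB0 : 0 ≤ B) (hB : ∀ a, |g a - g' a| ≤ B) : l1 (w - w') ≤ ε * B := by
  have h1 := hR.add_sq_le_of_isMaxOn hε hw hw' hmax
  have h2 := hR.add_sq_le_of_isMaxOn hε hw' hw hmax'
  rw [l1_sub_comm] at h2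
  have h3 := (le_abs_self _).trans (abs_dotProduct_le (x := w - w') (y := g - g') hB)
  rw [dotProduct_comm, sub_dotProduct, dotProduct_sub, dotProduct_sub] at h3
  have h4 : l1 (w - w') ^ 2 / ε ≤ l1 (w - w') * B := by
    have : l1 (w - w') ^ 2 / ε = l1 (w - w') ^ 2 / (2 * ε) + l1 (w - w') ^ 2 / (2 * ε) := by
      field_simp
      ring
    linarith
  rw [div_le_iff₀ hε] at h4
  rcases (l1_nonneg (w - w')).eq_or_lt with h0 | h0
  · rw [← h0]
    positivity
  · refine le_of_mul_le_mul_left ?_ h0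
    linarith

/-- The regret of optimistic follow-the-regularized-leader with predictions `M n` of the payoffs
`Q n`. The induction bounds the regularized payoff of every `v` at once, so the unpredicted
leaders, which need not exist for a discontinuous `R`, do not enter. -/
theorem IsRegularizer.optimistic_regret_le (hR : IsRegularizer R) (hε : 0 < ε) {N : ℕ}
    {Q M w : ℕ → A → ℝ} {B : ℕ → ℝ} (hw : ∀ n < N, w n ∈ stdSimplex ℝ A)
    (hmax : ∀ n < N, IsMaxOn (fun x => (∑ i ∈ Finset.range n, Q i + M n) ⬝ᵥ x - R x / ε)
      (stdSimplex ℝ A) (w n))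
    (hB : ∀ n < N, ∀ a, |Q n a - M n a| ≤ B n) (hv : v ∈ stdSimplex ℝ A) :
    ∑ n ∈ Finset.range N, Q n ⬝ᵥ (v - w n) ≤
      regularizerRange R / ε + ε / 2 * ∑ n ∈ Finset.range N, B n ^ 2 := by
  have key : ∀ n ≤ N, ∀ x ∈ stdSimplex ℝ A, (∑ i ∈ Finset.range n, Q i) ⬝ᵥ x - R x / ε ≤
      (regularizerRange R - R v) / ε + ∑ i ∈ Finset.range n, Q i ⬝ᵥ w i +
        ε / 2 * ∑ i ∈ Finset.range n, B i ^ 2 := by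
    intro n
    induction n with
    | zero =>
      intro _ x hx
      simp only [Finset.range_zero, Finset.sum_empty, zero_dotProduct, mul_zero, add_zero]
      have := div_le_div_of_nonneg_right (hR.sub_le_range hv hx) hε.le
      rw [sub_div] at this ⊢
      linarith
    | succ n ih =>
      intro hn x hx
      have hn' : n < N := hn
      have h1 := ih hn'.le (w n) (hw n hn')
      have h2 := hR.add_sq_le_of_isMaxOn hε (hw n hn') hx (hmax n hn')
      have h3 := (le_abs_self _).trans
        (abs_dotProduct_le (x := x - w n) (y := Q n - M n) (hB n hn'))
      rw [dotProduct_comm, sub_dotProduct, dotProduct_sub, dotProduct_sub, l1_sub_comm] at h3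
      rw [add_dotProduct, add_dotProduct] at h2
      rw [Finset.sum_range_succ, Finset.sum_range_succ, Finset.sum_range_succ, add_dotProduct]
      -- Young's inequality for the prediction error against the quadratic decay
      have h4 : l1 (w n - x) * B n ≤ l1 (w n - x) ^ 2 / (2 * ε) + ε / 2 * B n ^ 2 := by
        have : l1 (w n - x) ^ 2 / (2 * ε) + ε / 2 * B n ^ 2 - l1 (w n - x) * B n =
            (l1 (w n - x) - ε * B n) ^ 2 / (2 * ε) := by
          field_simp
          ring
        have : 0 ≤ (l1 (w n - x) - ε * B n) ^ 2 / (2 * ε) := by positivity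
        linarith
      linarith
  have h := key N le_rfl v hv
  simp only [dotProduct_sub, Finset.sum_sub_distrib]
  rw [sum_dotProduct, sub_div] at h
  linarith

end Regularizer

/-! ### Policy changes -/

section PolicyChange

variable {S A : Type*} [Fintype A]

theorem policyChange_nonneg (T : ℕ) (π : ℕ → Policy S A) : 0 ≤ policyChange T π := by
  refine Real.sSup_nonneg ?_
  rintro _ ⟨t, s, -, -, rfl⟩
  exact Finset.sum_nonneg fun _ _ => abs_nonneg _

theorem l1_sub_le_policyChange {T t : ℕ} (π : ℕ → Policy S A) (h2 : 2 ≤ t) (hT : t ≤ T) (s : S) :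
    l1 ((π t s).1 - (π (t - 1) s).1) ≤ policyChange T π := by
  refine le_csSup ⟨2, ?_⟩ ⟨t, s, h2, hT, rfl⟩
  rintro _ ⟨t, s, -, -, rfl⟩
  exact l1_sub_le_two (π t s).2 (π (t - 1) s).2

end PolicyChange

/-! ### Regrouping the experts into runs -/

/-- The pairs `(t, τ)` of an episode and an expert, grouped by `j = t + Γ - τ`. Group `j` collects
the episodes in which the window of an expert starts at the same episode `j + 1 - Γ`; the
episodes that exist are those from `max 1 (j + 1 - Γ)` to `min j T`. -/
theorem sum_experts_eq_sum_runs {T Γ : ℕ} (f : ℕ → ℕ → ℝ) :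
    ∑ t ∈ Finset.Icc 1 T, ∑ τ ∈ Finset.Icc 1 Γ, f t τ =
      ∑ j ∈ Finset.Icc 1 (T + Γ - 1),
        ∑ i ∈ Finset.range (min j T + 1 - max 1 (j + 1 - Γ)),
          f (max 1 (j + 1 - Γ) + i) (max 1 (j + 1 - Γ) + i + Γ - j) := by
  have h1 : ∀ t ∈ Finset.Icc 1 T, ∑ τ ∈ Finset.Icc 1 Γ, f t τ =
      ∑ j ∈ Finset.Ico t (t + Γ), f t (t + Γ - j) := by
    intro t _
    refine Finset.sum_nbij' (fun τ => t + Γ - τ) (fun j => t + Γ - j) ?_ ?_ ?_ ?_ ?_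
    · intro τ hτ
      simp only [Finset.mem_Icc, Finset.mem_Ico] at hτ ⊢
      omega
    · intro j hj
      simp only [Finset.mem_Icc, Finset.mem_Ico] at hj ⊢
      omega
    · intro τ hτ
      simp only [Finset.mem_Icc] at hτ
      omega
    · intro j hj
      simp only [Finset.mem_Ico] at hj
      omega
    · intro τ hτ
      simp only [Finset.mem_Icc] at hτ
      congr 1
      omega
  rw [Finset.sum_congr rfl h1, Finset.sum_comm' (t' := Finset.Icc 1 (T + Γ - 1))
    (s' := fun j => Finset.Ico (max 1 (j + 1 - Γ)) (min j T + 1))]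
  · refine Finset.sum_congr rfl fun j _ => ?_
    rw [Finset.sum_Ico_eq_sum_range]
  · intro t j
    simp only [Finset.mem_Icc, Finset.mem_Ico]
    omega

namespace MDP

variable {S A₁ A₂ : Type*} [Fintype S] [Fintype A₁] [Fintype A₂]
variable {G : MDP S A₁ A₂} {ω : ℝ}

theorem qHist_of_pos (G : MDP S A₁ A₂) (π₁ : ℕ → Policy S A₁) (π₂ : ℕ → Policy S A₂) {t : ℕ}
    (ht : 1 ≤ t) (s : S) (a : A₁) : G.qHist π₁ π₂ t s a = G.qValue (π₁ t) (π₂ t) s a :=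
  if_neg (by omega)

@[simp] theorem qHist_zero (G : MDP S A₁ A₂) (π₁ : ℕ → Policy S A₁) (π₂ : ℕ → Policy S A₂)
    (s : S) (a : A₁) : G.qHist π₁ π₂ 0 s a = 0 := if_pos rfl

theorem IsMixingTime.abs_qHist_le (h : G.IsMixingTime ω) (hω : 0 < ω) (π₁ : ℕ → Policy S A₁)
    (π₂ : ℕ → Policy S A₂) (t : ℕ) (s : S) (a : A₁) : |G.qHist π₁ π₂ t s a| ≤ 3 / gap ω := by
  rcases Nat.eq_zero_or_pos t with rfl | ht
  · rw [qHist_zero, abs_zero]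
    have := gap_pos hω
    positivity
  · rw [G.qHist_of_pos π₁ π₂ ht]
    exact h.abs_qValue_le hω _ _ s a

/-- Along a run that starts in episode `a`, the expert sees the payoffs of the earlier episodes
of the run. This includes the windows that reach back before episode `1`, as `Q` vanishes
there. -/
theorem windowQ_eq_sum_range (G : MDP S A₁ A₂) (π₁ : ℕ → Policy S A₁) (π₂ : ℕ → Policy S A₂)
    {a i τ : ℕ} (hτ : τ = i + 1 ∨ (a = 1 ∧ i + 1 ≤ τ)) (s : S) :
    G.windowQ π₁ π₂ (a + i) τ s = ∑ n ∈ Finset.range i, G.qHist π₁ π₂ (a + n) s +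
      G.qHist π₁ π₂ (a + i - 1) s := by
  ext c
  rw [windowQ, Pi.add_apply, Finset.sum_apply]
  congr 1
  have h1 : ∑ k ∈ Finset.Icc 1 (τ - 1), G.qHist π₁ π₂ (a + i - k) s c =
      ∑ k ∈ Finset.Icc 1 i, G.qHist π₁ π₂ (a + i - k) s c := by
    rcases hτ with rfl | ⟨rfl, hτ⟩
    · rfl
    · refine (Finset.sum_subset ?_ ?_).symm
      · exact Finset.Icc_subset_Icc le_rfl (by omega)
      · intro k _ hk
        simp only [Finset.mem_Icc, not_and, not_le] at *
        have : 1 + i - k = 0 := by omega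
        rw [this, qHist_zero]
  rw [h1]
  refine Finset.sum_nbij' (fun k => i - k) (fun n => i - n) ?_ ?_ ?_ ?_ ?_
  · intro k hk
    simp only [Finset.mem_Icc, Finset.mem_range] at hk ⊢
    omega
  · intro n hn
    simp only [Finset.mem_Icc, Finset.mem_range] at hn ⊢
    omega
  · intro k hk
    simp only [Finset.mem_Icc] at hk
    omega
  · intro n hn
    simp only [Finset.mem_range] at hn
    omega
  · intro k hk
    simp only [Finset.mem_Icc] at hk
    congr 1
    omega

theorem IsMixingTime.abs_windowQ_sub_le (h : G.IsMixingTime ω) (hω : 0 < ω)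
    (π₁ : ℕ → Policy S A₁) (π₂ : ℕ → Policy S A₂) (t τ : ℕ) (s : S) (a : A₁) :
    |G.windowQ π₁ π₂ t τ s a - G.windowQ π₁ π₂ (t - 1) τ s a| ≤ 12 / gap ω := by
  -- consecutive windows share all but their end points
  have tel : ∀ (q : ℕ → ℝ) (m : ℕ), ∑ k ∈ Finset.Icc 1 m, q (t - k) -
      ∑ k ∈ Finset.Icc 1 m, q (t - 1 - k) = q (t - 1) - q (t - 1 - m) := by
    intro q m
    induction m with
    | zero => simp
    | succ m ih =>
      rw [Finset.sum_Icc_succ_top (by omega), Finset.sum_Icc_succ_top (by omega)]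
      have : t - (m + 1) = t - 1 - m := by omega
      rw [this]
      linarith
  have e := tel (fun k => G.qHist π₁ π₂ k s a) (τ - 1)
  have b := fun k => abs_le.1 (h.abs_qHist_le hω π₁ π₂ k s a)
  have e12 : 12 / gap ω = 4 * (3 / gap ω) := by ring
  rw [windowQ, windowQ, abs_le, e12]
  have b1 := b (t - 1)
  have b2 := b (t - 1 - 1)
  have b3 := b (t - 1 - (τ - 1))
  constructor <;> linarith [b1.1, b1.2, b2.1, b2.2, b3.1, b3.2]

/-! ### The regret in terms of the horizon and the learning rate -/

theorem IsMixingTime.l1_stationaryDist_drift_le (h : G.IsMixingTime ω) (hω : 0 < ω)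
    {T : ℕ} (π : Policy S A₁) (π₂ : ℕ → Policy S A₂) {a : ℕ} (ha : 1 ≤ a) (i : ℕ)
    (hi : a + i ≤ T) :
    l1 (G.stationaryDist π (π₂ (a + i)) - G.stationaryDist π (π₂ a)) ≤
      i * (policyChange T π₂ / gap ω) := by
  induction i with
  | zero => simp
  | succ i ih =>
    have h1 := h.l1_stationaryDist_sub_le hω (π₁ := π) (π₁' := π) (δ₁ := 0)
      (fun s => by rw [sub_self, l1_zero])
      (l1_sub_le_policyChange π₂ (t := a + (i + 1)) (by omega) hi)
    rw [zero_add] at h1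
    refine (l1_sub_le_trans _ (G.stationaryDist π (π₂ (a + (i + 1) - 1))) _).trans ?_
    have h2 := ih (by omega)
    have : a + (i + 1) - 1 = a + i := by omega
    rw [this] at h1 ⊢
    push_cast
    linarith

/-- A bound for the change of the `Q`-values from episode `t - 1` to episode `t`, when the policy
changes are at most `δ`; there are no `Q`-values before episode `1`. -/
noncomputable def qStep (ω δ : ℝ) (t : ℕ) : ℝ :=
  if t = 1 then 3 / gap ω else 9 / gap ω ^ 2 * δ

section Run

variable {R : (A₁ → ℝ) → ℝ} {Γ T : ℕ} {ε : ℝ} {π₁ : ℕ → Policy S A₁} {π₂ : ℕ → Policy S A₂}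
  {w : ℕ → ℕ → Policy S A₁}

/-- The learner changes its policy slowly, because every expert does. -/
theorem IsMixingTime.l1_policy_sub_le (h : G.IsMixingTime ω) (hω : 0 < ω)
    (hR : IsRegularizer R) (hε : 0 < ε)
    (hmax : ∀ t ∈ Finset.Icc 1 T, ∀ τ ∈ Finset.Icc 1 Γ, ∀ s,
      IsMaxOn (fun v : A₁ → ℝ => ∑ a, G.windowQ π₁ π₂ t τ s a * v a - R v / ε)
        (stdSimplex ℝ A₁) (w t τ s).1)
    (havg : ∀ t ∈ Finset.Icc 1 T, ∀ s a,
      (π₁ t s).1 a = (1 / (Γ : ℝ)) * ∑ τ ∈ Finset.Icc 1 Γ, (w t τ s).1 a)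
    {t : ℕ} (h2 : 2 ≤ t) (hT : t ≤ T) (s : S) :
    l1 ((π₁ t s).1 - (π₁ (t - 1) s).1) ≤ 12 / gap ω * ε := by
  have hg := gap_pos hω
  have ht : t ∈ Finset.Icc 1 T := Finset.mem_Icc.2 ⟨by omega, hT⟩
  have ht' : t - 1 ∈ Finset.Icc 1 T := Finset.mem_Icc.2 ⟨by omega, by omega⟩
  have e : (π₁ t s).1 - (π₁ (t - 1) s).1 =
      (1 / (Γ : ℝ)) • ∑ τ ∈ Finset.Icc 1 Γ, ((w t τ s).1 - (w (t - 1) τ s).1) := by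
    ext a
    simp only [Pi.sub_apply, Pi.smul_apply, Finset.sum_apply, smul_eq_mul]
    rw [havg t ht, havg _ ht', Finset.sum_sub_distrib, mul_sub]
  have hs : l1 (∑ τ ∈ Finset.Icc 1 Γ, ((w t τ s).1 - (w (t - 1) τ s).1)) ≤
      Γ * (12 / gap ω * ε) := by
    refine (l1_sum_le _ _).trans ?_
    refine (Finset.sum_le_sum fun τ hτ => ?_ : _ ≤ ∑ τ ∈ Finset.Icc 1 Γ, 12 / gap ω * ε).trans ?_
    · rw [mul_comm]
      exact hR.l1_sub_le_of_isMaxOn hε (w t τ s).2 (w (t - 1) τ s).2 (hmax t ht τ hτ s)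
        (hmax _ ht' τ hτ s) (by positivity) fun a => h.abs_windowQ_sub_le hω π₁ π₂ t τ s a
    · simp
  rw [e, l1_smul, abs_of_nonneg (by positivity)]
  rcases Nat.eq_zero_or_pos Γ with rfl | hΓ
  · simp only [Nat.cast_zero, div_zero, zero_mul]
    positivity
  · have hΓ' : (0 : ℝ) < Γ := by exact_mod_cast hΓ
    calc _ ≤ 1 / (Γ : ℝ) * (Γ * (12 / gap ω * ε)) := by gcongr
      _ = _ := by field_simp

theorem IsMixingTime.abs_qHist_sub_le (h : G.IsMixingTime ω) (hω : 0 < ω) {δ₁ : ℝ}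
    (hδ₁ : 0 ≤ δ₁)
    (h₁ : ∀ t, 2 ≤ t → t ≤ T → ∀ s, l1 ((π₁ t s).1 - (π₁ (t - 1) s).1) ≤ δ₁)
    {t : ℕ} (ht : 1 ≤ t) (hT : t ≤ T) (s : S) (a : A₁) :
    |G.qHist π₁ π₂ t s a - G.qHist π₁ π₂ (t - 1) s a| ≤
      qStep ω (δ₁ + policyChange T π₂) t := by
  rw [qStep]
  split_ifs with h1
  · subst h1
    rw [Nat.sub_self, qHist_zero, sub_zero]
    exact h.abs_qHist_le hω π₁ π₂ 1 s a
  · rw [G.qHist_of_pos π₁ π₂ ht, G.qHist_of_pos π₁ π₂ (by omega : 1 ≤ t - 1)]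
    exact h.abs_qValue_sub_le hω (h₁ t (by omega) hT)
      (fun s => l1_sub_le_policyChange π₂ (by omega) hT s) hδ₁ (policyChange_nonneg T π₂) s a

/-- The regret of one run of experts, weighted with the stationary distributions of the
comparator `π`. These drift by at most `policyChange / gap` per episode, so they can be
replaced by the one of the first episode `a` of the run. -/
theorem IsMixingTime.run_regret_le (h : G.IsMixingTime ω) (hω : 0 < ω)
    (hR : IsRegularizer R) (hε : 0 < ε)
    (hmax : ∀ t ∈ Finset.Icc 1 T, ∀ τ ∈ Finset.Icc 1 Γ, ∀ s,
      IsMaxOn (fun v : A₁ → ℝ => ∑ a, G.windowQ π₁ π₂ t τ s a * v a - R v / ε)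
        (stdSimplex ℝ A₁) (w t τ s).1)
    {δ₁ : ℝ} (hδ₁ : 0 ≤ δ₁)
    (h₁ : ∀ t, 2 ≤ t → t ≤ T → ∀ s, l1 ((π₁ t s).1 - (π₁ (t - 1) s).1) ≤ δ₁)
    {a N : ℕ} {σ : ℕ → ℕ} (ha : 1 ≤ a) (hN : N ≤ Γ) (hT : ∀ i < N, a + i ≤ T)
    (hσΓ : ∀ i < N, σ i ≤ Γ) (hσ : ∀ i < N, σ i = i + 1 ∨ (a = 1 ∧ i + 1 ≤ σ i))
    (π : Policy S A₁) :
    ∑ i ∈ Finset.range N, ∑ s, G.stationaryDist π (π₂ (a + i)) s *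
        (G.qHist π₁ π₂ (a + i) s ⬝ᵥ ((π s).1 - (w (a + i) (σ i) s).1)) ≤
      regularizerRange R / ε + ∑ i ∈ Finset.range N,
        (ε / 2 * qStep ω (δ₁ + policyChange T π₂) (a + i) ^ 2 +
          6 / gap ω ^ 2 * Γ * policyChange T π₂) := by
  have hg := gap_pos hω
  have hρ := policyChange_nonneg T π₂
  set d : ℕ → S → ℝ := fun t => G.stationaryDist π (π₂ t) with hd
  set x : ℕ → S → ℝ := fun i s =>
    G.qHist π₁ π₂ (a + i) s ⬝ᵥ ((π s).1 - (w (a + i) (σ i) s).1) with hx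
  have hrun : ∀ s, ∑ i ∈ Finset.range N, x i s ≤ regularizerRange R / ε +
      ε / 2 * ∑ i ∈ Finset.range N, qStep ω (δ₁ + policyChange T π₂) (a + i) ^ 2 := by
    intro s
    refine hR.optimistic_regret_le hε (Q := fun i => G.qHist π₁ π₂ (a + i) s)
      (M := fun i => G.qHist π₁ π₂ (a + i - 1) s) (w := fun i => (w (a + i) (σ i) s).1)
      (fun i _ => (w (a + i) (σ i) s).2) (fun i hi => ?_) (fun i hi c => ?_) (π s).2
    · have hm := hmax (a + i) (Finset.mem_Icc.2 ⟨by omega, hT i hi⟩) (σ i)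
        (Finset.mem_Icc.2 ⟨by have := hσ i hi; omega, hσΓ i hi⟩) s
      rw [← G.windowQ_eq_sum_range π₁ π₂ (hσ i hi)]
      exact hm
    · exact h.abs_qHist_sub_le hω hδ₁ h₁ (by omega) (hT i hi) s c
  have hda : d a ∈ stdSimplex ℝ S := h.stationaryDist_mem hω π (π₂ a)
  have hfix : ∑ i ∈ Finset.range N, d a ⬝ᵥ x i ≤ regularizerRange R / ε +
      ε / 2 * ∑ i ∈ Finset.range N, qStep ω (δ₁ + policyChange T π₂) (a + i) ^ 2 := by
    have e : ∑ i ∈ Finset.range N, d a ⬝ᵥ x i = ∑ s, d a s * ∑ i ∈ Finset.range N, x i s := by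
      simp only [dotProduct, Finset.mul_sum]
      rw [Finset.sum_comm]
    rw [e]
    refine (Finset.sum_le_sum fun s _ => mul_le_mul_of_nonneg_left (hrun s) (hda.1 s)).trans ?_
    rw [← Finset.sum_mul, hda.2, one_mul]
  have hxb : ∀ i s, |x i s| ≤ 6 / gap ω := by
    intro i s
    simp only [hx]
    rw [dotProduct_comm]
    refine (abs_dotProduct_le fun c => h.abs_qHist_le hω π₁ π₂ (a + i) s c).trans ?_
    have := l1_sub_le_two (π s).2 (w (a + i) (σ i) s).2
    calc _ ≤ 2 * (3 / gap ω) := by gcongr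
      _ = _ := by ring
  have hdrift : ∀ i ∈ Finset.range N, d (a + i) ⬝ᵥ x i ≤
      d a ⬝ᵥ x i + 6 / gap ω ^ 2 * Γ * policyChange T π₂ := by
    intro i hi
    rw [Finset.mem_range] at hi
    have e1 := (le_abs_self _).trans (abs_dotProduct_le (x := d (a + i) - d a) (hxb i))
    have e2 : l1 (d (a + i) - d a) ≤ i * (policyChange T π₂ / gap ω) :=
      h.l1_stationaryDist_drift_le hω π π₂ ha i (hT i hi)
    have hiΓ : (i : ℝ) ≤ Γ := by exact_mod_cast (hi.trans_le hN).le
    have e3 : l1 (d (a + i) - d a) * (6 / gap ω) ≤ 6 / gap ω ^ 2 * Γ * policyChange T π₂ := by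
      calc _ ≤ (Γ * (policyChange T π₂ / gap ω)) * (6 / gap ω) := by
            gcongr
            exact e2.trans (by gcongr)
        _ = _ := by field_simp
    rw [sub_dotProduct] at e1
    linarith
  have := Finset.sum_le_sum hdrift
  rw [Finset.sum_add_distrib] at this
  rw [Finset.sum_add_distrib, ← Finset.mul_sum]
  change ∑ i ∈ Finset.range N, d (a + i) ⬝ᵥ x i ≤ _
  linarith

/-- The regret bound with explicit dependence on horizon and learning rate: averaging over the
experts turns the regret into `1 / Γ` times the sum of the regrets of fewer than `T + Γ` runs. -/
theorem IsExpDRBias.sum_avgReward_sub_le (hexp : G.IsExpDRBias R Γ ε T π₁ π₂)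
    (h : G.IsMixingTime ω) (hω : 0 < ω) (hR : IsRegularizer R) (hε : 0 < ε) (hΓ : 1 ≤ Γ)
    (hΓT : Γ ≤ T) (π : Policy S A₁) :
    ∑ t ∈ Finset.Icc 1 T, (G.avgReward π (π₂ t) - G.avgReward (π₁ t) (π₂ t)) ≤
      2 * T * (regularizerRange R / (ε * Γ)) +
      ε / 2 * ((3 / gap ω) ^ 2 +
        T * (9 / gap ω ^ 2 * (12 / gap ω * ε + policyChange T π₂)) ^ 2) +
      T * (6 / gap ω ^ 2 * Γ * policyChange T π₂) := by
  obtain ⟨w, hmax, havg⟩ := hexp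
  have hg := gap_pos hω
  have hΓ0 : (0 : ℝ) < Γ := by exact_mod_cast hΓ
  set ρ := policyChange T π₂ with hρ
  have hT : 1 ∈ Finset.Icc 1 T := Finset.mem_Icc.2 ⟨le_rfl, hΓ.trans hΓT⟩
  set δ := 12 / gap ω * ε + ρ with hδ
  have h₁ : ∀ t, 2 ≤ t → t ≤ T → ∀ s, l1 ((π₁ t s).1 - (π₁ (t - 1) s).1) ≤ 12 / gap ω * ε :=
    fun t h2 ht s => h.l1_policy_sub_le hω hR hε hmax havg h2 ht s
  set f : ℕ → ℕ → ℝ := fun t τ => ∑ s, G.stationaryDist π (π₂ t) s *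
    (G.qHist π₁ π₂ t s ⬝ᵥ ((π s).1 - (w t τ s).1)) with hf
  set b : ℕ → ℝ := fun t => ε / 2 * qStep ω δ t ^ 2 + 6 / gap ω ^ 2 * Γ * ρ with hb
  have hlhs : ∀ t ∈ Finset.Icc 1 T, G.avgReward π (π₂ t) - G.avgReward (π₁ t) (π₂ t) =
      1 / (Γ : ℝ) * ∑ τ ∈ Finset.Icc 1 Γ, f t τ := by
    intro t ht
    rw [h.avgReward_sub_eq hω]
    simp only [hf]
    rw [Finset.sum_comm, Finset.mul_sum]
    refine Finset.sum_congr rfl fun s _ => ?_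
    rw [← Finset.mul_sum, mul_left_comm, ← dotProduct_sum, ← smul_eq_mul (1 / (Γ : ℝ)),
      ← dotProduct_smul, dotProduct_comm]
    congr 1
    refine Finset.sum_congr rfl fun c _ => ?_
    rw [G.qHist_of_pos π₁ π₂ (Finset.mem_Icc.1 ht).1]
    congr 1
    simp only [Pi.smul_apply, Finset.sum_apply, Pi.sub_apply, smul_eq_mul]
    rw [Finset.sum_sub_distrib, mul_sub, ← havg t ht, Finset.sum_const, Nat.card_Icc,
      Nat.add_sub_cancel, nsmul_eq_mul]
    field_simp
  have hruns : ∑ t ∈ Finset.Icc 1 T, ∑ τ ∈ Finset.Icc 1 Γ, f t τ ≤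
      2 * T * (regularizerRange R / ε) + ∑ t ∈ Finset.Icc 1 T, ∑ τ ∈ Finset.Icc 1 Γ, b t := by
    rw [sum_experts_eq_sum_runs f, sum_experts_eq_sum_runs fun t _ => b t]
    have hrun : ∀ j ∈ Finset.Icc 1 (T + Γ - 1), _ ≤ _ := fun j hj =>
      h.run_regret_le hω hR hε hmax (by positivity) h₁
        (a := max 1 (j + 1 - Γ)) (N := min j T + 1 - max 1 (j + 1 - Γ))
        (σ := fun i => max 1 (j + 1 - Γ) + i + Γ - j) (le_max_left _ _) (by omega)
        (fun i hi => by omega) (fun i hi => by omega)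
        (fun i hi => by rw [Finset.mem_Icc] at hj; omega) π
    refine (Finset.sum_le_sum hrun).trans ?_
    rw [Finset.sum_add_distrib]
    refine add_le_add ?_ le_rfl
    rw [Finset.sum_const, Nat.card_Icc, nsmul_eq_mul]
    have hr0 : 0 ≤ regularizerRange R := by
      obtain ⟨s⟩ := G.nonempty_state
      exact hR.range_nonneg (π s).2
    have hc : ((T + Γ - 1 + 1 - 1 : ℕ) : ℝ) ≤ 2 * T := by
      have : T + Γ - 1 + 1 - 1 ≤ 2 * T := by omega
      exact_mod_cast this
    exact mul_le_mul_of_nonneg_right hc (by positivity)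
  have hbs : ∑ t ∈ Finset.Icc 1 T, b t ≤ ε / 2 * ((3 / gap ω) ^ 2 +
      T * (9 / gap ω ^ 2 * δ) ^ 2) + T * (6 / gap ω ^ 2 * Γ * ρ) := by
    simp only [hb]
    rw [Finset.sum_add_distrib, ← Finset.mul_sum, Finset.sum_const, Nat.card_Icc,
      Nat.add_sub_cancel, nsmul_eq_mul]
    refine add_le_add (mul_le_mul_of_nonneg_left ?_ (by positivity)) le_rfl
    rw [← Finset.add_sum_erase _ _ hT]
    refine add_le_add (by simp [qStep]) ?_
    refine (Finset.sum_le_card_nsmul _ _ ((9 / gap ω ^ 2 * δ) ^ 2) fun t ht => ?_).trans ?_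
    · rw [qStep, if_neg (Finset.ne_of_mem_erase ht)]
    · rw [nsmul_eq_mul]
      refine mul_le_mul_of_nonneg_right ?_ (sq_nonneg _)
      have := Finset.card_erase_le (s := Finset.Icc 1 T) (a := 1)
      rw [Nat.card_Icc, Nat.add_sub_cancel] at this
      exact_mod_cast this
  rw [Finset.sum_congr rfl hlhs, ← Finset.mul_sum]
  have e : ∑ t ∈ Finset.Icc 1 T, ∑ τ ∈ Finset.Icc 1 Γ, b t = Γ * ∑ t ∈ Finset.Icc 1 T, b t := by
    rw [Finset.mul_sum]
    refine Finset.sum_congr rfl fun t _ => ?_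
    rw [Finset.sum_const, Nat.card_Icc, Nat.add_sub_cancel, nsmul_eq_mul]
  calc _ ≤ 1 / (Γ : ℝ) * (2 * T * (regularizerRange R / ε) +
        Γ * ∑ t ∈ Finset.Icc 1 T, b t) := by
        rw [← e]
        gcongr
    _ = 2 * T * (regularizerRange R / (ε * Γ)) + ∑ t ∈ Finset.Icc 1 T, b t := by
        field_simp
    _ ≤ _ := by rw [add_assoc]; gcongr

end Run

end MDP

/-! ### The choice of the horizon -/

theorem IsHorizon.bounds {α : ℝ} (hα : 0 < α) {T Γ : ℕ} (hT : 1 ≤ T) (hΓ : IsHorizon α T Γ) :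
    1 ≤ Γ ∧ Γ ≤ T ∧ min ((T : ℝ) ^ (4 / 7 * α)) (T : ℝ) / 2 ≤ Γ ∧
      (Γ : ℝ) ≤ 2 * min ((T : ℝ) ^ (4 / 7 * α)) (T : ℝ) := by
  have hT1 : (1 : ℝ) ≤ T := by exact_mod_cast hT
  have hx1 : 1 ≤ min ((T : ℝ) ^ (4 / 7 * α)) (T : ℝ) :=
    le_min (Real.one_le_rpow hT1 (by positivity)) hT1
  have hxT : min ((T : ℝ) ^ (4 / 7 * α)) (T : ℝ) ≤ T := min_le_right _ _
  rw [IsHorizon] at hΓ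
  set x := min ((T : ℝ) ^ (4 / 7 * α)) (T : ℝ)
  rcases hΓ with rfl | rfl
  · have h1 : 1 ≤ ⌊x⌋₊ := Nat.le_floor (by exact_mod_cast hx1)
    have h1' : (1 : ℝ) ≤ ⌊x⌋₊ := by exact_mod_cast h1
    have h2 := Nat.floor_le (zero_le_one.trans hx1)
    have h3 := Nat.lt_floor_add_one x
    refine ⟨h1, ?_, by linarith, by linarith⟩
    exact_mod_cast h2.trans hxT
  · have h2 := Nat.le_ceil x
    have h3 := Nat.ceil_lt_add_one (zero_le_one.trans hx1)
    refine ⟨?_, Nat.ceil_le.2 hxT, by linarith, by linarith⟩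
    exact_mod_cast hx1.trans h2

/-- The horizon balances the two rates of the regret: the price of restarting, proportional to
`T * Γ ^ (-3/4)`, and the price of the drift of the other agent, proportional to
`T * Γ * T ^ (-α)`. -/
theorem IsHorizon.rates {α : ℝ} (hα : 0 < α) {T Γ : ℕ} (hT : 1 ≤ T) (hΓ : IsHorizon α T Γ) :
    (T : ℝ) * (Γ : ℝ) ^ (-(3 / 4) : ℝ) ≤ 4 * (T : ℝ) ^ (max (1 - 3 / 7 * α) (1 / 4)) ∧
    (T : ℝ) * Γ * (T : ℝ) ^ (-α) ≤ 2 * (T : ℝ) ^ (max (1 - 3 / 7 * α) (1 / 4)) := by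
  obtain ⟨h1, -, hlow, hup⟩ := hΓ.bounds hα hT
  have hT1 : (1 : ℝ) ≤ T := by exact_mod_cast hT
  have hT0 : (0 : ℝ) < T := by linarith
  have e1 : (T : ℝ) ^ (1 - 3 / 7 * α) ≤ (T : ℝ) ^ (max (1 - 3 / 7 * α) (1 / 4)) :=
    Real.rpow_le_rpow_of_exponent_le hT1 (le_max_left _ _)
  have e2 : (T : ℝ) ^ (1 / 4 : ℝ) ≤ (T : ℝ) ^ (max (1 - 3 / 7 * α) (1 / 4)) :=
    Real.rpow_le_rpow_of_exponent_le hT1 (le_max_right _ _)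
  have hx1 : 1 ≤ min ((T : ℝ) ^ (4 / 7 * α)) (T : ℝ) :=
    le_min (Real.one_le_rpow hT1 (by positivity)) hT1
  constructor
  · have h3 : (Γ : ℝ) ^ (-(3 / 4) : ℝ) ≤
        2 * min ((T : ℝ) ^ (4 / 7 * α)) (T : ℝ) ^ (-(3 / 4) : ℝ) := by
      set x := min ((T : ℝ) ^ (4 / 7 * α)) (T : ℝ)
      calc (Γ : ℝ) ^ (-(3 / 4) : ℝ) ≤ (x / 2) ^ (-(3 / 4) : ℝ) :=
            Real.rpow_le_rpow_of_nonpos (by linarith) hlow (by norm_num)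
        _ = 2 ^ (3 / 4 : ℝ) * x ^ (-(3 / 4) : ℝ) := by
            rw [Real.div_rpow (by linarith) (by norm_num), Real.rpow_neg (by norm_num : (0:ℝ) ≤ 2)]
            field_simp
        _ ≤ _ := by
            refine mul_le_mul_of_nonneg_right ?_ (Real.rpow_nonneg (by linarith) _)
            calc (2 : ℝ) ^ (3 / 4 : ℝ) ≤ 2 ^ (1 : ℝ) :=
                  Real.rpow_le_rpow_of_exponent_le (by norm_num) (by norm_num)
              _ = 2 := Real.rpow_one 2
    have h4 : (T : ℝ) * min ((T : ℝ) ^ (4 / 7 * α)) (T : ℝ) ^ (-(3 / 4) : ℝ) ≤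
        (T : ℝ) ^ (max (1 - 3 / 7 * α) (1 / 4)) := by
      rcases min_choice ((T : ℝ) ^ (4 / 7 * α)) (T : ℝ) with hm | hm <;> rw [hm]
      · refine le_trans (le_of_eq ?_) e1
        rw [← Real.rpow_mul hT0.le, sub_eq_add_neg, Real.rpow_add hT0, Real.rpow_one]
        congr 2
        ring
      · refine le_trans (le_of_eq ?_) e2
        nth_rewrite 1 [← Real.rpow_one (T : ℝ)]
        rw [← Real.rpow_add hT0]
        norm_num
    have h5 := mul_le_mul_of_nonneg_left h3 hT0.le
    have h6 : 0 ≤ (T : ℝ) ^ (max (1 - 3 / 7 * α) (1 / 4)) := Real.rpow_nonneg hT0.le _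
    linarith
  · have h3 : (Γ : ℝ) ≤ 2 * (T : ℝ) ^ (4 / 7 * α) := hup.trans (by gcongr; exact min_le_left _ _)
    calc (T : ℝ) * Γ * (T : ℝ) ^ (-α) ≤ (T : ℝ) * (2 * (T : ℝ) ^ (4 / 7 * α)) * (T : ℝ) ^ (-α) := by
          gcongr
      _ = 2 * (T : ℝ) ^ (1 - 3 / 7 * α) := by
          have : (1 - 3 / 7 * α) = 1 + 4 / 7 * α + -α := by ring
          rw [this, Real.rpow_add hT0, Real.rpow_add hT0, Real.rpow_one]
          ring
      _ ≤ _ := by gcongr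

/-- The constant of the regret bound. -/
noncomputable def regretConst (c ω D : ℝ) : ℝ :=
  8 * D + 9 / gap ω ^ 2 + 81 / gap ω ^ 4 * (576 / gap ω ^ 2 + c ^ 2) + 12 / gap ω ^ 2 * c

namespace MDP

variable {S A₁ A₂ : Type*} [Fintype S] [Fintype A₁] [Fintype A₂]
variable {G : MDP S A₁ A₂} {ω : ℝ}

theorem IsExpDRBias.sum_avgReward_sub_le_rate {α c D : ℝ} (hα : 0 < α) (hω : 0 < ω)
    {R : (A₁ → ℝ) → ℝ} {T Γ : ℕ} {π₁ : ℕ → Policy S A₁} {π₂ : ℕ → Policy S A₂}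
    (h : G.IsMixingTime ω) (hR : IsRegularizer R) (hD : regularizerRange R ≤ D) (hT : 1 ≤ T)
    (hΓ : IsHorizon α T Γ) (hexp : G.IsExpDRBias R Γ ((Γ : ℝ) ^ (-(1 / 4) : ℝ)) T π₁ π₂)
    (hc : policyChange T π₂ ≤ c * (T : ℝ) ^ (-α)) (π : Policy S A₁) :
    ∑ t ∈ Finset.Icc 1 T, (G.avgReward π (π₂ t) - G.avgReward (π₁ t) (π₂ t)) ≤
      regretConst c ω D * (T : ℝ) ^ (max (1 - 3 / 7 * α) (1 / 4)) := by
  obtain ⟨hΓ1, hΓT, -, -⟩ := hΓ.bounds hα hT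
  obtain ⟨hr1, hr2⟩ := hΓ.rates hα hT
  have hg := gap_pos hω
  have hT1 : (1 : ℝ) ≤ T := by exact_mod_cast hT
  have hT0 : (0 : ℝ) < T := by linarith
  have hG1 : (1 : ℝ) ≤ Γ := by exact_mod_cast hΓ1
  have hG0 : (0 : ℝ) < Γ := by linarith
  set ε := (Γ : ℝ) ^ (-(1 / 4) : ℝ) with hε
  have hε0 : 0 < ε := Real.rpow_pos_of_pos hG0 _
  have hε1 : ε ≤ 1 := Real.rpow_le_one_of_one_le_of_nonpos hG1 (by norm_num)
  have hε3 : ε ^ 3 = (Γ : ℝ) ^ (-(3 / 4) : ℝ) := by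
    rw [hε, ← Real.rpow_natCast, ← Real.rpow_mul hG0.le]
    norm_num
  have hεΓ : 1 / (ε * Γ) = (Γ : ℝ) ^ (-(3 / 4) : ℝ) := by
    nth_rewrite 1 [← Real.rpow_one (Γ : ℝ)]
    rw [hε, ← Real.rpow_add hG0, one_div, ← Real.rpow_neg hG0.le]
    norm_num
  set X := (T : ℝ) ^ (max (1 - 3 / 7 * α) (1 / 4)) with hX
  have hX1 : 1 ≤ X := Real.one_le_rpow hT1 (le_max_of_le_right (by norm_num))
  set ρ := policyChange T π₂ with hρ
  have hρ0 : 0 ≤ ρ := policyChange_nonneg T π₂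
  have hc0 : 0 ≤ c := by
    by_contra hneg
    have := mul_neg_of_neg_of_pos (not_le.1 hneg) (Real.rpow_pos_of_pos hT0 (-α))
    linarith
  have hD0 : 0 ≤ D := by
    obtain ⟨s⟩ := G.nonempty_state
    exact (hR.range_nonneg (π s).2).trans hD
  have b1 : 2 * T * (regularizerRange R / (ε * Γ)) ≤ 8 * D * X := by
    calc 2 * T * (regularizerRange R / (ε * Γ)) ≤ 2 * T * (D / (ε * Γ)) := by gcongr
      _ = 2 * D * (T * (1 / (ε * Γ))) := by ring
      _ ≤ 2 * D * (4 * X) := by rw [hεΓ]; gcongr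
      _ = _ := by ring
  have b2 : T * (6 / gap ω ^ 2 * Γ * ρ) ≤ 12 / gap ω ^ 2 * c * X := by
    calc T * (6 / gap ω ^ 2 * Γ * ρ) ≤ T * (6 / gap ω ^ 2 * Γ * (c * (T : ℝ) ^ (-α))) := by gcongr
      _ = 6 / gap ω ^ 2 * c * (T * Γ * (T : ℝ) ^ (-α)) := by ring
      _ ≤ 6 / gap ω ^ 2 * c * (2 * X) := by gcongr
      _ = _ := by ring
  have b3 : T * (ε * ρ ^ 2) ≤ c ^ 2 * X := by
    calc T * (ε * ρ ^ 2) ≤ T * (1 * (c * (T : ℝ) ^ (-α)) ^ 2) := by gcongr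
      _ = c ^ 2 * (T : ℝ) ^ (1 - 2 * α) := by
          have : 1 - 2 * α = 1 + (-α + -α) := by ring
          rw [this, Real.rpow_add hT0, Real.rpow_add hT0, Real.rpow_one]
          ring
      _ ≤ c ^ 2 * X := by
          refine mul_le_mul_of_nonneg_left ?_ (sq_nonneg c)
          exact Real.rpow_le_rpow_of_exponent_le hT1 (le_max_of_le_left (by linarith))
  have b4 : ε / 2 * (T * (9 / gap ω ^ 2 * (12 / gap ω * ε + ρ)) ^ 2) ≤
      81 / gap ω ^ 4 * (576 / gap ω ^ 2 + c ^ 2) * X := by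
    have hsq : (12 / gap ω * ε + ρ) ^ 2 ≤ 2 * (12 / gap ω * ε) ^ 2 + 2 * ρ ^ 2 := by
      nlinarith [sq_nonneg (12 / gap ω * ε - ρ)]
    calc ε / 2 * (T * (9 / gap ω ^ 2 * (12 / gap ω * ε + ρ)) ^ 2)
        = ε / 2 * (T * ((9 / gap ω ^ 2) ^ 2 * (12 / gap ω * ε + ρ) ^ 2)) := by ring
      _ ≤ ε / 2 * (T * ((9 / gap ω ^ 2) ^ 2 * (2 * (12 / gap ω * ε) ^ 2 + 2 * ρ ^ 2))) := by
          gcongr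
      _ = 81 / gap ω ^ 4 * (144 / gap ω ^ 2 * (T * ε ^ 3) + T * (ε * ρ ^ 2)) := by
          field_simp
          ring
      _ ≤ 81 / gap ω ^ 4 * (144 / gap ω ^ 2 * (4 * X) + c ^ 2 * X) := by
          rw [hε3]
          gcongr
      _ = _ := by ring
  have b5 : ε / 2 * (3 / gap ω) ^ 2 ≤ 9 / gap ω ^ 2 * X := by
    have e : (3 / gap ω) ^ 2 = 9 / gap ω ^ 2 := by ring
    rw [e]
    have : ε / 2 ≤ X := by linarith
    have h9 : 0 ≤ 9 / gap ω ^ 2 := by positivity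
    nlinarith
  have key := hexp.sum_avgReward_sub_le h hω hR hε0 hΓ1 hΓT π
  rw [mul_add] at key
  simp only [regretConst, add_mul]
  linarith

/-! ### From the regret to the return -/

theorem IsMixingTime.abs_episodeReturn_sub_le (h : G.IsMixingTime ω) (hω : 0 < ω) {M : ℕ}
    (hM : 1 ≤ M) (π₁ : Policy S A₁) (π₂ : Policy S A₂) :
    |G.episodeReturn M π₁ π₂ - G.avgReward π₁ π₂| ≤ 2 / gap ω * (1 / (M : ℝ)) := by
  have hM0 : (0 : ℝ) < M := by exact_mod_cast hM
  have e : G.episodeReturn M π₁ π₂ - G.avgReward π₁ π₂ = 1 / (M : ℝ) *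
      (G.deviation π₁ π₂ G.init.1 M ⬝ᵥ G.stateReward π₁ π₂) := by
    rw [deviation_dotProduct, Finset.sum_sub_distrib, Finset.sum_const, Finset.card_range,
      nsmul_eq_mul, mul_sub, episodeReturn]
    field_simp
  rw [e, abs_mul, abs_of_pos (by positivity), mul_comm]
  refine mul_le_mul_of_nonneg_right ?_ (by positivity)
  refine (abs_dotProduct_le (G.abs_stateReward_le π₁ π₂)).trans ?_
  rw [mul_one]
  exact h.l1_deviation_le hω π₁ π₂ G.init.2 M

theorem IsMixingTime.abs_avgReturn_sub_le (h : G.IsMixingTime ω) (hω : 0 < ω) {T M : ℕ}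
    (hT : 1 ≤ T) (hM : 1 ≤ M) (π₁ : ℕ → Policy S A₁) (π₂ : ℕ → Policy S A₂) :
    |G.avgReturn T M π₁ π₂ - 1 / (T : ℝ) * ∑ t ∈ Finset.Icc 1 T, G.avgReward (π₁ t) (π₂ t)| ≤
      2 / gap ω * (1 / (M : ℝ)) := by
  have hT0 : (0 : ℝ) < T := by exact_mod_cast hT
  rw [avgReturn, ← mul_sub, ← Finset.sum_sub_distrib, abs_mul, abs_of_pos (by positivity)]
  have hs : |∑ t ∈ Finset.Icc 1 T,
      (G.episodeReturn M (π₁ t) (π₂ t) - G.avgReward (π₁ t) (π₂ t))| ≤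
      T * (2 / gap ω * (1 / (M : ℝ))) := by
    refine (Finset.abs_sum_le_sum_abs _ _).trans ((Finset.sum_le_sum fun t _ =>
      h.abs_episodeReturn_sub_le hω hM (π₁ t) (π₂ t)).trans ?_)
    simp
  calc _ ≤ 1 / (T : ℝ) * (T * (2 / gap ω * (1 / (M : ℝ)))) := by gcongr
    _ = _ := by field_simp

theorem IsMixingTime.abs_opt_sub_le (h : G.IsMixingTime ω) (hω : 0 < ω) {T M : ℕ}
    (hT : 1 ≤ T) (hM : 1 ≤ M) {σ₁ : Policy S A₁} {σ₂ : Policy S A₂}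
    (hσ : ∀ π₁ π₂, G.avgReward π₁ π₂ ≤ G.avgReward σ₁ σ₂) :
    |G.opt T M - G.avgReward σ₁ σ₂| ≤ 2 / gap ω * (1 / (M : ℝ)) := by
  have hT0 : (0 : ℝ) < T := by exact_mod_cast hT
  have hconst : ∀ x : ℝ, 1 / (T : ℝ) * ∑ _t ∈ Finset.Icc 1 T, x = x := by
    intro x
    simp only [Finset.sum_const, Nat.card_Icc, Nat.add_sub_cancel, nsmul_eq_mul]
    field_simp
  have hub : ∀ π : (ℕ → Policy S A₁) × (ℕ → Policy S A₂),
      G.avgReturn T M π.1 π.2 ≤ G.avgReward σ₁ σ₂ + 2 / gap ω * (1 / (M : ℝ)) := by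
    intro π
    have h1 := (abs_le.1 (h.abs_avgReturn_sub_le hω hT hM π.1 π.2)).2
    have h2 : 1 / (T : ℝ) * ∑ t ∈ Finset.Icc 1 T, G.avgReward (π.1 t) (π.2 t) ≤
        G.avgReward σ₁ σ₂ := by
      conv_rhs => rw [← hconst (G.avgReward σ₁ σ₂)]
      exact mul_le_mul_of_nonneg_left (Finset.sum_le_sum fun t _ => hσ _ _) (by positivity)
    linarith
  have hbdd : BddAbove (Set.range fun π : (ℕ → Policy S A₁) × (ℕ → Policy S A₂) =>
      G.avgReturn T M π.1 π.2) := by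
    refine ⟨G.avgReward σ₁ σ₂ + 2 / gap ω * (1 / (M : ℝ)), ?_⟩
    rintro _ ⟨π, rfl⟩
    exact hub π
  have hne : Nonempty ((ℕ → Policy S A₁) × (ℕ → Policy S A₂)) := ⟨fun _ => σ₁, fun _ => σ₂⟩
  have hle : G.opt T M ≤ _ := ciSup_le hub
  have hge : G.avgReturn T M (fun _ => σ₁) (fun _ => σ₂) ≤ G.opt T M :=
    le_ciSup hbdd (fun _ => σ₁, fun _ => σ₂)
  have h1 := (abs_le.1 (h.abs_avgReturn_sub_le hω hT hM (fun _ => σ₁) fun _ => σ₂)).1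
  rw [hconst] at h1
  rw [abs_le]
  constructor <;> linarith

/-- In a smooth MDP, a bound `B` on the regret against every fixed policy bounds the return from
below: the regret against the smoothness policy is played off against the optimum. -/
theorem IsSmooth.le_avgReturn {lam mu B : ℝ} (hs : G.IsSmooth lam mu) (hmu : -1 < mu)
    (h : G.IsMixingTime ω) (hω : 0 < ω) {T M : ℕ} (hT : 1 ≤ T) (hM : 1 ≤ M)
    {π₁ : ℕ → Policy S A₁} {π₂ : ℕ → Policy S A₂}
    (hB : ∀ π : Policy S A₁,
      ∑ t ∈ Finset.Icc 1 T, (G.avgReward π (π₂ t) - G.avgReward (π₁ t) (π₂ t)) ≤ B) :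
    lam / (1 + mu) * G.opt T M - 1 / (1 + mu) * (B / T) -
      (2 / gap ω + |lam| / (1 + mu) * (2 / gap ω)) * (1 / (M : ℝ)) ≤
      G.avgReturn T M π₁ π₂ := by
  obtain ⟨σ₁, σ₂, hσ⟩ := hs
  have hT0 : (0 : ℝ) < T := by exact_mod_cast hT
  have hmu0 : 0 < 1 + mu := by linarith
  set K := 2 / gap ω * (1 / (M : ℝ)) with hK
  set E := 1 / (T : ℝ) * ∑ t ∈ Finset.Icc 1 T, G.avgReward (π₁ t) (π₂ t) with hE
  have hopt := h.abs_opt_sub_le hω hT hM fun π₁ π₂ => (hσ π₁ π₂).2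
  rw [← hK] at hopt
  have hret := (abs_le.1 (h.abs_avgReturn_sub_le hω hT hM π₁ π₂)).1
  have h1 : lam * G.avgReward σ₁ σ₂ - B / T ≤ (1 + mu) * E := by
    have h2 : ∑ t ∈ Finset.Icc 1 T,
        (lam * G.avgReward σ₁ σ₂ - (1 + mu) * G.avgReward (π₁ t) (π₂ t)) ≤ B := by
      refine le_trans (Finset.sum_le_sum fun t _ => ?_) (hB σ₁)
      linarith [(hσ (π₁ t) (π₂ t)).1]
    rw [Finset.sum_sub_distrib, Finset.sum_const, Nat.card_Icc, Nat.add_sub_cancel,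
      nsmul_eq_mul, ← Finset.mul_sum] at h2
    have h3 := div_le_div_of_nonneg_right h2 hT0.le
    have h4 : (T * (lam * G.avgReward σ₁ σ₂) -
        (1 + mu) * ∑ t ∈ Finset.Icc 1 T, G.avgReward (π₁ t) (π₂ t)) / T =
        lam * G.avgReward σ₁ σ₂ - (1 + mu) * E := by
      rw [hE]
      field_simp
    linarith
  have h2 : lam * G.opt T M - |lam| * K ≤ lam * G.avgReward σ₁ σ₂ := by
    have := (le_abs_self _).trans_eq (abs_mul lam (G.opt T M - G.avgReward σ₁ σ₂))
    have := mul_le_mul_of_nonneg_left hopt (abs_nonneg lam)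
    linarith
  have h3 : (lam * G.opt T M - |lam| * K - B / T) / (1 + mu) ≤ E := by
    rw [div_le_iff₀ hmu0]
    linarith
  have h4 : lam / (1 + mu) * G.opt T M - 1 / (1 + mu) * (B / T) -
      (2 / gap ω + |lam| / (1 + mu) * (2 / gap ω)) * (1 / (M : ℝ)) =
      (lam * G.opt T M - |lam| * K - B / T) / (1 + mu) - K := by
    rw [hK]
    ring
  rw [h4]
  linarith

end MDP

end TwoAgent

theorem mainTheorem1 (α c ω D : ℝ) (hα : 0 < α) (hω : 0 < ω) :
    (∃ C : ℝ, ∀ (S : Type u) (A₁ : Type v) (A₂ : Type w) [Fintype S] [Fintype A₁] [Fintype A₂]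
      (G : TwoAgent.MDP S A₁ A₂) (R : (A₁ → ℝ) → ℝ) (T Γ : ℕ)
      (π₁ : ℕ → TwoAgent.Policy S A₁) (π₂ : ℕ → TwoAgent.Policy S A₂),
      G.IsMixingTime ω → TwoAgent.IsRegularizer R → TwoAgent.regularizerRange R ≤ D →
      1 ≤ T → TwoAgent.IsHorizon α T Γ →
      G.IsExpDRBias R Γ ((Γ : ℝ) ^ (-(1 / 4) : ℝ)) T π₁ π₂ →
      TwoAgent.policyChange T π₂ ≤ c * (T : ℝ) ^ (-α) →
      G.regret T π₁ π₂ ≤ C * (T : ℝ) ^ (max (1 - 3 / 7 * α) (1 / 4))) ∧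
    (∀ lam mu : ℝ, -1 < mu →
      ∃ C₁ C₂ : ℝ, ∀ (S : Type u) (A₁ : Type v) (A₂ : Type w) [Fintype S] [Fintype A₁] [Fintype A₂]
        (G : TwoAgent.MDP S A₁ A₂) (R : (A₁ → ℝ) → ℝ) (T Γ M : ℕ)
        (π₁ : ℕ → TwoAgent.Policy S A₁) (π₂ : ℕ → TwoAgent.Policy S A₂),
        G.IsMixingTime ω → TwoAgent.IsRegularizer R → TwoAgent.regularizerRange R ≤ D →
        1 ≤ T → 1 ≤ M → TwoAgent.IsHorizon α T Γ →
        G.IsExpDRBias R Γ ((Γ : ℝ) ^ (-(1 / 4) : ℝ)) T π₁ π₂ →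
        TwoAgent.policyChange T π₂ ≤ c * (T : ℝ) ^ (-α) →
        G.IsSmooth lam mu →
        G.avgReturn T M π₁ π₂ ≥ lam / (1 + mu) * G.opt T M
          - C₁ * (T : ℝ) ^ (max (-(3 / 7) * α) (-(3 / 4))) - C₂ * (1 / (M : ℝ))) := by
  refine ⟨⟨TwoAgent.regretConst c ω D, ?_⟩, fun lam mu hmu =>
    ⟨1 / (1 + mu) * TwoAgent.regretConst c ω D,
      2 / TwoAgent.gap ω + |lam| / (1 + mu) * (2 / TwoAgent.gap ω), ?_⟩⟩
  · intro S A₁ A₂ _ _ _ G R T Γ π₁ π₂ h hR hD hT hΓ hexp hc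
    have : Nonempty (TwoAgent.Policy S A₁) := ⟨π₁ 1⟩
    exact ciSup_le fun π => hexp.sum_avgReward_sub_le_rate hα hω h hR hD hT hΓ hc π
  · intro S A₁ A₂ _ _ _ G R T Γ M π₁ π₂ h hR hD hT hM hΓ hexp hc hs
    have hT0 : (0 : ℝ) < T := by exact_mod_cast hT
    have key := hs.le_avgReturn hmu h hω hT hM fun π =>
      hexp.sum_avgReward_sub_le_rate hα hω h hR hD hT hΓ hc π
    have e : max (-(3 / 7) * α) (-(3 / 4)) = max (1 - 3 / 7 * α) (1 / 4) - 1 := by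
      rw [← max_sub_sub_right]
      congr 1 <;> ring
    rw [e, Real.rpow_sub hT0, Real.rpow_one]
    refine ge_iff_le.2 (le_trans (le_of_eq ?_) key)
    ring
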